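/- For a totally real number field $F$, an element $\alpha$ of its ring of integers $\mathcal O_F$ is totally positive if $\sigma(\alpha)>0$ for every embedding $\sigma$ of $F$ into $\mathbb C$, and a totally positive $\alpha\in\mathcal O_F$ is called indecomposable in $F$ if it cannot be written as $\alpha=\beta+\gamma$ with $\beta,\gamma\in\mathcal O_F$ totally positive. For a squarefree integer $k>1$ let $\omega_k=\frac{1+\sqrt k}{2}$ if $k\equiv1\pmod 4$ and $\omega_k=\sqrt k$ if $k\equiv 2,3\pmod 4$, and let $\overline{\omega_k}$ be the Galois conjugate of $\omega_k$. Let $[u_0,u_1,u_2,\dots]$ be the (infinite, eventually periodic) continued fraction of $-\overline{\omega_k}$ and let $\frac{x_i}{y_i}=[u_0,\dots,u_i]$ ($i\ge 0$), in lowest terms with $y_i>0$. An element of $\mathbb{Q}(\sqrt k)$ is called a convergent of $-\overline{\omega_k}$ if it is equal to $x_i+y_i\omega_k$ for some $i\ge0$. Put $M_k=\max\{u_i : i \text{ odd}\}$. **Theorem.** Let $p,q>1$ be distinct squarefree integers, let $K=\mathbb{Q}(\sqrt p,\sqrt q)$, and let $r=\frac{pq}{\gcd(p,q)^2}$. (a)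 Let $\alpha$ be indecomposable in $\mathbb{Q}(\sqrt p)$. - If $\alpha$ is a convergent of $-\overline{\omega_p}$ and $\sqrt r>\sqrt p$, then $\alpha$ is indecomposable in $K$. - If $\sqrt r>M_p\sqrt p$, then $\alpha$ is indecomposable in $K$. (b) Let $\beta$ be indecomposable in $\mathbb{Q}(\sqrt q)$. - If $(p,q)$ is congruent modulo $4$ to $(2,3)$, $(2,1)$ or $(3,1)$, then $\beta$ is indecomposable in $K$. - If $p\equiv q\equiv 1\pmod 4$, $\sqrt r>\sqrt q$ and $\beta$ is a convergent of $-\overline{\omega_q}$, then $\beta$ is indecomposable in $K$. - If $p\equiv q\equiv 1\pmod 4$ and $\sqrt r>M_q\sqrt q$, then $\beta$ is indecomposable in $K$. (c) Let $\gamma$ be indecomposable in $\mathbb{Q}(\sqrt r)$. - If $\gamma$ is a convergent of $-\overline{\omega_r}$ and $\sqrt p>\sqrt r$, then $\gamma$ is indecomposable in $K$. - If $\sqrt p>M_r\sqrt r$, then $\gamma$ is indecomposable in $K$. -/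

import Mathlib

open scoped ComplexOrder NumberField

noncomputable section

namespace BiquadIndec

/-- `x` is totally positive: every embedding of `F` into `ℂ` sends it to a positive real number. (In
the scoped order on `ℂ`, `0 < z` means that `z` is real and positive.) -/
def TotallyPositive {F : Type*} [Field F] (x : F) : Prop :=
  ∀ σ : F →+* ℂ, 0 < σ x

/-- An indecomposable element of `𝓞 F`: a totally positive integer that is not the sum of two totally
positive integers. -/
def IsIndecomposable {F : Type*} [Field F] (a : 𝓞 F) : Prop :=
  TotallyPositive (a : F) ∧
    ¬ ∃ b c : 𝓞 F, TotallyPositive (b : F) ∧ TotallyPositive (c : F) ∧ a = b + c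

/-- The real number `α` lies in the subfield `F` of `ℝ`, and is an indecomposable integer of `F`. -/
def IndecomposableIn (F : IntermediateField ℚ ℝ) (α : ℝ) : Prop :=
  ∃ a : 𝓞 F, ((a : F) : ℝ) = α ∧ IsIndecomposable a

/-- The field `ℚ(√k)`. -/
def quadraticField (k : ℕ) : IntermediateField ℚ ℝ :=
  IntermediateField.adjoin ℚ {√(k : ℝ)}

/-- The field `ℚ(√p, √q)`. -/
def biquadraticField (p q : ℕ) : IntermediateField ℚ ℝ :=
  IntermediateField.adjoin ℚ {√(p : ℝ), √(q : ℝ)}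

/-- `ω_k`: the standard generator of the ring of integers of `ℚ(√k)`. -/
def omega (k : ℕ) : ℝ :=
  if k % 4 = 1 then (1 + √(k : ℝ)) / 2 else √(k : ℝ)

/-- The Galois conjugate of `ω_k`. -/
def omegaConj (k : ℕ) : ℝ :=
  if k % 4 = 1 then (1 - √(k : ℝ)) / 2 else -√(k : ℝ)

/-- The continued fraction `[u₀, u₁, u₂, …]` of `-ω̄_k`. -/
def contFrac (k : ℕ) : GenContFract ℝ :=
  GenContFract.of (-omegaConj k)

/-- `α` is a convergent of `-ω̄_k`, in the sense of an algebraic integer: `α = x_i + y_i ω_k`, where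
`x_i / y_i = [u₀, …, u_i]`. -/
def IsConvergent (k : ℕ) (α : ℝ) : Prop :=
  ∃ i : ℕ, α = (contFrac k).nums i + (contFrac k).dens i * omega k

/-- The set of the partial quotients `u_i` with `i` odd. (Mathlib numbers the partial denominators
after `u₀` from `0`, so that `u_i` has the position `i - 1`.) -/
def oddPartialQuotients (k : ℕ) : Set ℕ :=
  {u | ∃ i : ℕ, Odd i ∧ (contFrac k).partDens.get? (i - 1) = some (u : ℝ)}

/-- `M_k`, the largest partial quotient of odd index of the continued fraction of `-ω̄_k`. That this
maximum exists is shown in `isGreatest_maxOddQuotient`. -/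
def maxOddQuotient (k : ℕ) : ℕ :=
  sSup (oddPartialQuotients k)

theorem exists_int_contsAux (v : ℝ) (n : ℕ) :
    (∃ x y : ℤ, (GenContFract.of v).contsAux n = ⟨(x : ℝ), (y : ℝ)⟩) ∧
      ∃ x y : ℤ, (GenContFract.of v).contsAux (n + 1) = ⟨(x : ℝ), (y : ℝ)⟩ := by
  induction n with
  | zero =>
    refine ⟨⟨1, 0, ?_⟩, ⟨⌊v⌋, 1, ?_⟩⟩
    · simp [GenContFract.contsAux]
    · simp [GenContFract.contsAux, GenContFract.of_h_eq_floor]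
  | succ n ih =>
    refine ⟨ih.2, ?_⟩
    obtain ⟨⟨x, y, h⟩, ⟨x', y', h'⟩⟩ := ih
    cases hs : (GenContFract.of v).s.get? n with
    | none =>
      exact ⟨x', y', by
        rw [GenContFract.contsAux_stable_step_of_terminated (n := n) hs, h']⟩
    | some gp =>
      obtain ⟨ha, z, hz⟩ := GenContFract.of_partNum_eq_one_and_exists_int_partDen_eq hs
      refine ⟨z * x' + x, z * y' + y, ?_⟩
      rw [GenContFract.contsAux_recurrence hs h h', ha, hz]
      simp

theorem irrational_sqrt_of_squarefree {k : ℕ} (hk : Squarefree k) (h1 : 1 < k) :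
    Irrational √(k : ℝ) := by
  rw [irrational_sqrt_natCast_iff]
  rintro ⟨a, rfl⟩
  have := Nat.isUnit_iff.1 (hk a (dvd_refl _))
  subst this
  omega

theorem irrational_neg_omegaConj {k : ℕ} (hk : Squarefree k) (h1 : 1 < k) :
    Irrational (-omegaConj k) := by
  have h := irrational_sqrt_of_squarefree hk h1
  unfold omegaConj
  rintro ⟨a, ha⟩
  apply h
  split_ifs at ha with h4
  · exact ⟨2 * a + 1, by push_cast; linarith⟩
  · exact ⟨a, by linarith⟩

/-- The sum and the product of `-ω̄_k` and `-ω_k` are integers. -/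
theorem exists_int_trace_norm (k : ℕ) :
    ∃ t m : ℤ, -omegaConj k + -omega k = t ∧ -omegaConj k * -omega k = m := by
  have hs : √(k : ℝ) * √(k : ℝ) = k := Real.mul_self_sqrt (Nat.cast_nonneg k)
  unfold omegaConj omega
  split_ifs with h4
  · obtain ⟨j, hj⟩ : ∃ j : ℕ, k = 4 * j + 1 := ⟨k / 4, by omega⟩
    have hj' : (k : ℝ) = 4 * j + 1 := by exact_mod_cast hj
    exact ⟨-1, -j, by push_cast; ring, by push_cast; nlinarith⟩
  · exact ⟨0, -k, by push_cast; ring, by push_cast; nlinarith⟩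

theorem partDen_le {k : ℕ} (hk : Squarefree k) (h1 : 1 < k) {n : ℕ} {b : ℝ}
    (hb : (contFrac k).partDens.get? n = some b) :
    b ≤ 1 + |(-omegaConj k) - (-omega k)| := by
  set v := -omegaConj k with hv
  set w := -omega k with hw
  have hirr : Irrational v := irrational_neg_omegaConj hk h1
  obtain ⟨t, m, ht, hm⟩ := exists_int_trace_norm k
  rw [← hv, ← hw] at ht hm
  obtain ⟨-, x, y, hxy⟩ := exists_int_contsAux v n
  have hb' : (GenContFract.of v).partDens.get? n = some b := hb
  have hb1 : 1 ≤ b := GenContFract.of_one_le_get?_partDen hb'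
  have happ := GenContFract.abs_sub_convergents_le' hb'
  have hnum : (GenContFract.of v).nums n = x := by
    rw [GenContFract.num_eq_conts_a, GenContFract.nth_cont_eq_succ_nth_contAux, hxy]
  have hden : (GenContFract.of v).dens n = y := by
    rw [GenContFract.den_eq_conts_b, GenContFract.nth_cont_eq_succ_nth_contAux, hxy]
  have hterm : ¬ (GenContFract.of v).Terminates := by
    intro h
    obtain ⟨a, ha⟩ := GenContFract.exists_rat_eq_of_terminates h
    exact hirr ⟨a, ha.symm⟩
  have hy1 : (1 : ℝ) ≤ y := by
    have hf : ((Nat.fib (n + 1) : ℕ) : ℝ) ≤ (GenContFract.of v).dens n := by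
      apply GenContFract.succ_nth_fib_le_of_nth_den
      right
      intro h
      exact hterm ⟨n - 1, h⟩
    rw [hden] at hf
    have : 1 ≤ Nat.fib (n + 1) := Nat.fib_pos.2 (Nat.succ_pos n)
    exact le_trans (by exact_mod_cast this) hf
  have hy0 : (0 : ℝ) < y := by linarith
  rw [GenContFract.conv_eq_num_div_den, hnum, hden] at happ
  -- the norm of `x - y v` is a nonzero integer
  have hN : ((x : ℝ) - y * v) * (x - y * w) = ((x ^ 2 - x * y * t + y ^ 2 * m : ℤ) : ℝ) := by
    push_cast
    rw [← ht, ← hm]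
    ring
  have hw_irr : Irrational w := by
    have : w = (t : ℝ) - v := by linarith
    rw [this]
    exact hirr.intCast_sub t
  have hne : ∀ u : ℝ, Irrational u → (x : ℝ) - y * u ≠ 0 := by
    intro u hu h
    apply hu
    refine ⟨(x : ℚ) / y, ?_⟩
    push_cast
    field_simp
    linarith
  have hN1 : 1 ≤ |(x : ℝ) - y * v| * |(x : ℝ) - y * w| := by
    rw [← abs_mul, hN]
    have h0 : (x ^ 2 - x * y * t + y ^ 2 * m : ℤ) ≠ 0 := by
      intro h
      rw [h, Int.cast_zero] at hN
      rcases mul_eq_zero.1 hN with h | h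
      · exact hne v hirr h
      · exact hne w hw_irr h
    exact_mod_cast Int.one_le_abs h0
  have e1 : |(x : ℝ) - y * v| = y * |v - x / y| := by
    rw [← abs_of_pos hy0, ← abs_mul, abs_of_pos hy0, abs_sub_comm]
    congr 1
    field_simp
  have e2 : |(x : ℝ) - y * w| ≤ y * (|v - x / y| + |v - w|) := by
    have : (x : ℝ) - y * w = y * (-(v - x / y) + (v - w)) := by
      field_simp
      ring
    rw [this, abs_mul, abs_of_pos hy0]
    gcongr
    exact (abs_add_le _ _).trans (by rw [abs_neg])
  set δ := |v - x / y| with hδ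
  set D := |v - w| with hD
  have hδ0 : 0 ≤ δ := abs_nonneg _
  have hD0 : 0 ≤ D := abs_nonneg _
  have hbyy : 1 ≤ b * y * y := by nlinarith [mul_le_mul hb1 hy1 zero_le_one (by linarith)]
  have hle : δ * (b * y * y) ≤ 1 := by
    rwa [le_div_iff₀ (by linarith)] at happ
  have hδ1 : δ ≤ 1 := by nlinarith
  have h2 : 1 ≤ (y * δ) * (y * (δ + D)) := by
    rw [e1] at hN1
    exact hN1.trans (by gcongr)
  have h3 : b ≤ (δ * (b * y * y)) * (δ + D) := by nlinarith
  calc b ≤ (δ * (b * y * y)) * (δ + D) := h3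
    _ ≤ 1 * (δ + D) := by gcongr
    _ ≤ 1 + D := by linarith

/-- The maximum in the definition of `M_k` exists. -/
theorem isGreatest_maxOddQuotient {k : ℕ} (hk : Squarefree k) (h1 : 1 < k) :
    IsGreatest (oddPartialQuotients k) (maxOddQuotient k) := by
  have hbdd : BddAbove (oddPartialQuotients k) := by
    refine ⟨⌈1 + |(-omegaConj k) - (-omega k)|⌉₊, ?_⟩
    rintro u ⟨i, -, hi⟩
    have h := (partDen_le hk h1 hi).trans (Nat.le_ceil _)
    exact_mod_cast h
  have hne : (oddPartialQuotients k).Nonempty := by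
    have hterm : ¬ (contFrac k).TerminatedAt 0 := by
      intro h
      obtain ⟨a, ha⟩ := GenContFract.exists_rat_eq_of_terminates (v := -omegaConj k) ⟨0, h⟩
      exact irrational_neg_omegaConj hk h1 ⟨a, ha.symm⟩
    rw [GenContFract.terminatedAt_iff_partDen_none] at hterm
    obtain ⟨b, hb⟩ := Option.ne_none_iff_exists'.1 hterm
    obtain ⟨z, hz⟩ := GenContFract.exists_int_eq_of_partDen hb
    have hb1 : 1 ≤ b := GenContFract.of_one_le_get?_partDen hb
    have hz0 : 0 ≤ z := by
      have : (0 : ℝ) ≤ z := by linarith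
      exact_mod_cast this
    lift z to ℕ using hz0
    exact ⟨z, 1, odd_one, by rw [hb, hz]; simp⟩
  exact ⟨Nat.sSup_mem hne hbdd, fun u hu => le_csSup hbdd hu⟩

end BiquadIndec

end

noncomputable section

namespace BiquadIndec

/-! ### Convergents of an irrational number -/

/-! Write `p = ab`, `q = ac`, `r = bc`. The hypotheses are symmetric enough under permuting `p`,
`q`, `r` that it suffices to treat an indecomposable `α` of `ℚ(√p)`. Suppose `α = y + z` with `y`,
`z` totally positive integers of the biquadratic field, `y = x₀ + x₁√p + x₂√q + x₃√r`, and let `σ`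
fix `√p` and negate `√q`, `√r`. The component `x₀ + x₁√p` is half the relative trace of `y`, so it
is totally positive, and so is the component of `z`. If the component of `y` is an algebraic
integer, `α` therefore decomposes already in `ℚ(√p)`, a contradiction
(`indecomposableIn_of_component`). Its integrality is obtained in two ways.

Size. Both `y` and `σ y` lie between `0` and `α`, so `δ = y - σ y` satisfies `|δ| < α`, and likewise
for the conjugates. Now `κ = aδ/√q` is an integer of `ℚ(√p)`, and `|κ| = |δ|√p/√r`. If `√r > N√p`,
then `N|κ| < α` under both embeddings, and `Rigid N` forces `κ = 0`. So `y` lies in `ℚ(√p)`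
(`indecomposableIn_of_rigid`).

Rigidity comes from continued fractions. Consecutive convergents `α_n`, `α_{n+1}` form a lattice
basis, and for even `n` in the shifted numbering the first is totally positive, the second of mixed
signature. Up to conjugation every indecomposable is a semiconvergent `α_n + l α_{n+1}` with `0 ≤ l
≤ u n`. If `M|κ|` is smaller than it under both embeddings, the `α_n`-coordinate of `κ` vanishes,
and the two embeddings bound the other coordinate `t` by `M|t| ≤ l` and `M|t| ≤ u n - l`. Hence `M ≥
u n` suffices, and for `l = 0` already `M = 1`.

Congruences. For the listed residues modulo `4`, the relative norm `y * σ y`, an integer of `ℚ(√p)`,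
forces the parities that make the component integral (`halfIntegral_component`). -/

/-- `X n / Y n = [u₀, …, u_{n-1}]` are the convergents of `v`, starting from `1 / 0`, and `u n` is the
partial quotient of index `n + 1`. -/
structure ConvergentRecurrence (v : ℝ) (X Y : ℕ → ℤ) (u : ℕ → ℕ) : Prop where
  X_zero : X 0 = 1
  Y_zero : Y 0 = 0
  X_one : X 1 = ⌊v⌋
  Y_one : Y 1 = 1
  X_rec : ∀ n, X (n + 2) = u n * X (n + 1) + X n
  Y_rec : ∀ n, Y (n + 2) = u n * Y (n + 1) + Y n
  u_pos : ∀ n, 1 ≤ u n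
  alternating : ∀ n, ∃ f : ℝ, 0 < f ∧ f < 1 ∧ X (n + 1) - Y (n + 1) * v = -f * (X n - Y n * v)

theorem exists_stream_irrational {v : ℝ} (hv : Irrational v) (n : ℕ) :
    ∃ P : GenContFract.IntFractPair ℝ, GenContFract.IntFractPair.stream v n = some P ∧
      Irrational P.fr ∧ 0 < P.fr ∧ P.fr < 1 := by
  have key : ∀ w : ℝ, Irrational w → Irrational (GenContFract.IntFractPair.of w).fr ∧
      0 < (GenContFract.IntFractPair.of w).fr ∧ (GenContFract.IntFractPair.of w).fr < 1 := by
    intro w hw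
    have h : Irrational (Int.fract w) := by
      rw [Int.fract]; exact hw.sub_intCast _
    exact ⟨h, lt_of_le_of_ne (Int.fract_nonneg w) (fun h0 => h.ne_zero h0.symm),
      Int.fract_lt_one w⟩
  induction n with
  | zero => exact ⟨_, GenContFract.IntFractPair.stream_zero v, key v hv⟩
  | succ n ih =>
    obtain ⟨P, hP, hi, h0, -⟩ := ih
    exact ⟨_, GenContFract.IntFractPair.stream_succ_of_some hP h0.ne', key _ hi.inv⟩

/-- The contraction factor in `alternating` is the fractional part of the `n`-th complete quotient.
Irrationality keeps it nonzero, so the expansion never stops. -/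
theorem exists_convergentRecurrence {v : ℝ} (hv : Irrational v) :
    ∃ (X Y : ℕ → ℤ) (u : ℕ → ℕ), ConvergentRecurrence v X Y u ∧
      (∀ n, (GenContFract.of v).contsAux n = ⟨(X n : ℝ), (Y n : ℝ)⟩) ∧
      ∀ n, (GenContFract.of v).partDens.get? n = some (u n : ℝ) := by
  choose P hP _hirr hpos hlt using exists_stream_irrational hv
  choose X Y hXY using fun n => (exists_int_contsAux v n).1
  have hsucc : ∀ n, P (n + 1) = GenContFract.IntFractPair.of (P n).fr⁻¹ := by
    intro n
    have h := GenContFract.IntFractPair.stream_succ_of_some (hP n) (hpos n).ne'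
    rw [hP (n + 1)] at h
    exact Option.some.inj h
  have hfl : ∀ n, 1 ≤ ⌊(P n).fr⁻¹⌋ := by
    intro n
    rw [Int.le_floor]
    push_cast
    exact (one_lt_inv₀ (hpos n)).2 (hlt n) |>.le
  have hs : ∀ n, (GenContFract.of v).s.get? n = some ⟨1, (⌊(P n).fr⁻¹⌋ : ℝ)⟩ := fun n =>
    GenContFract.get?_of_eq_some_of_get?_intFractPair_stream_fr_ne_zero (hP n) (hpos n).ne'
  have hcast : ∀ n, ((⌊(P n).fr⁻¹⌋.toNat : ℕ) : ℤ) = ⌊(P n).fr⁻¹⌋ := fun n =>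
    Int.toNat_of_nonneg (by linarith [hfl n])
  have hrec : ∀ n, X (n + 2) = ⌊(P n).fr⁻¹⌋ * X (n + 1) + X n ∧
      Y (n + 2) = ⌊(P n).fr⁻¹⌋ * Y (n + 1) + Y n := by
    intro n
    have h := GenContFract.contsAux_recurrence (hs n) (hXY n) (hXY (n + 1))
    rw [hXY (n + 2)] at h
    simp only [GenContFract.Pair.mk.injEq, one_mul] at h
    exact ⟨by exact_mod_cast h.1, by exact_mod_cast h.2⟩
  have h0 := hXY 0
  rw [GenContFract.zeroth_contAux_eq_one_zero] at h0
  have h1 := hXY 1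
  rw [GenContFract.first_contAux_eq_h_one, GenContFract.of_h_eq_floor] at h1
  simp only [GenContFract.Pair.mk.injEq] at h0 h1
  have hX0 : X 0 = 1 := by exact_mod_cast h0.1.symm
  have hY0 : Y 0 = 0 := by exact_mod_cast h0.2.symm
  have hX1 : X 1 = ⌊v⌋ := by exact_mod_cast h1.1.symm
  have hY1 : Y 1 = 1 := by exact_mod_cast h1.2.symm
  have halt : ∀ n, (X (n + 1) : ℝ) - Y (n + 1) * v = -(P n).fr * (X n - Y n * v) := by
    intro n
    induction n with
    | zero =>
      have hP0 : P 0 = GenContFract.IntFractPair.of v := by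
        have h := hP 0
        rw [GenContFract.IntFractPair.stream_zero] at h
        exact (Option.some.inj h).symm
      have : (P 0).fr = Int.fract v := by rw [hP0]; rfl
      rw [this, hX0, hY0, hX1, hY1, Int.fract]
      push_cast
      ring
    | succ n ih =>
      -- The recurrence adds `⌊1/f⌋` times the current error to the previous one, which is `-1/f`
      -- times the current error; what remains is minus the next fractional part.
      have hf : (P (n + 1)).fr = (P n).fr⁻¹ - ⌊(P n).fr⁻¹⌋ := by rw [hsucc n]; rfl
      rw [(hrec n).1, (hrec n).2, hf]
      push_cast
      have hne := (hpos n).ne'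
      have : (X n : ℝ) - Y n * v = -(P n).fr⁻¹ * (X (n + 1) - Y (n + 1) * v) := by
        rw [ih]; field_simp
      linear_combination this
  refine ⟨X, Y, fun n => ⌊(P n).fr⁻¹⌋.toNat, ⟨hX0, hY0, hX1, hY1, ?_, ?_, ?_, ?_⟩, hXY, ?_⟩
  · intro n; rw [hcast]; exact (hrec n).1
  · intro n; rw [hcast]; exact (hrec n).2
  · intro n
    have := hcast n
    have := hfl n
    omega
  · exact fun n => ⟨_, hpos n, hlt n, halt n⟩
  · intro n
    rw [GenContFract.partDen_eq_s_b (hs n)]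
    have : (⌊(P n).fr⁻¹⌋ : ℝ) = (⌊(P n).fr⁻¹⌋.toNat : ℕ) := by
      rw [← Int.cast_natCast, hcast]
    exact congrArg some this

namespace ConvergentRecurrence

variable {v : ℝ} {X Y : ℕ → ℤ} {u : ℕ → ℕ}

theorem det_sq (h : ConvergentRecurrence v X Y u) (n : ℕ) :
    X (n + 1) * Y n - X n * Y (n + 1) = 1 ∨ X (n + 1) * Y n - X n * Y (n + 1) = -1 := by
  induction n with
  | zero => right; rw [h.X_zero, h.Y_zero, h.Y_one]; ring
  | succ n ih =>
    have : X (n + 2) * Y (n + 1) - X (n + 1) * Y (n + 2) =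
        -(X (n + 1) * Y n - X n * Y (n + 1)) := by
      rw [h.X_rec, h.Y_rec]; ring
    rw [this]
    omega

/-- Consecutive convergents form a basis of `ℤ²`. -/
theorem exists_coords (h : ConvergentRecurrence v X Y u) (n : ℕ) (a b : ℤ) :
    ∃ s t : ℤ, a = s * X n + t * X (n + 1) ∧ b = s * Y n + t * Y (n + 1) := by
  rcases h.det_sq n with hd | hd
  · exact ⟨b * X (n + 1) - a * Y (n + 1), a * Y n - b * X n,
      by linear_combination (-a) * hd, by linear_combination (-b) * hd⟩
  · exact ⟨-(b * X (n + 1) - a * Y (n + 1)), -(a * Y n - b * X n),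
      by linear_combination a * hd, by linear_combination b * hd⟩

/-- With `v = -ω̄` the quantity `X n - Y n * v` is the conjugate of `X n + Y n * ω`, so the even
indices (odd in the usual numbering, which starts at `⌊v⌋ / 1`) give the totally positive
convergents. -/
theorem pos_of_even (h : ConvergentRecurrence v X Y u) {n : ℕ} (hn : Even n) :
    0 < (X n : ℝ) - Y n * v := by
  obtain ⟨m, rfl⟩ := hn
  induction m with
  | zero => simp [h.X_zero, h.Y_zero]
  | succ m ih =>
    obtain ⟨f, hf, -, e⟩ := h.alternating (m + m)
    obtain ⟨g, hg, -, e'⟩ := h.alternating (m + m + 1)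
    rw [show m + 1 + (m + 1) = m + m + 1 + 1 by ring, e', e]
    have : 0 < g * f * ((X (m + m) : ℝ) - Y (m + m) * v) := by positivity
    linarith

theorem neg_of_even (h : ConvergentRecurrence v X Y u) {n : ℕ} (hn : Even n) :
    (X (n + 1) : ℝ) - Y (n + 1) * v < 0 := by
  obtain ⟨f, hf, -, e⟩ := h.alternating n
  have := mul_pos hf (h.pos_of_even hn)
  linarith

/-- The errors strictly shrink, so the negative one outweighs its positive successor. This yields
the upper bound on `M|t|` at the far end of a run of semiconvergents. -/
theorem add_neg_of_even (h : ConvergentRecurrence v X Y u) {n : ℕ} (hn : Even n) :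
    ((X (n + 1) : ℝ) - Y (n + 1) * v) + (X (n + 2) - Y (n + 2) * v) < 0 := by
  obtain ⟨f, hf, hf1, e⟩ := h.alternating (n + 1)
  have := h.neg_of_even hn
  rw [show n + 1 + 1 = n + 2 from rfl] at e
  nlinarith

theorem even_of_pos (h : ConvergentRecurrence v X Y u) {n : ℕ}
    (hn : 0 < (X n : ℝ) - Y n * v) : Even n := by
  rcases Nat.even_or_odd' n with ⟨m, rfl | rfl⟩
  · exact even_two_mul m
  · exact absurd (h.neg_of_even (even_two_mul m)) (not_lt.2 hn.le)

theorem le_one_of_even (h : ConvergentRecurrence v X Y u) {n : ℕ} (hn : Even n) :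
    (X n : ℝ) - Y n * v ≤ 1 := by
  obtain ⟨m, rfl⟩ := hn
  induction m with
  | zero => simp [h.X_zero, h.Y_zero]
  | succ m ih =>
    have hp := h.pos_of_even (n := m + m) ⟨m, rfl⟩
    have hneg := h.neg_of_even (n := m + m) ⟨m, rfl⟩
    obtain ⟨g, hg, hg1, e'⟩ := h.alternating (m + m + 1)
    obtain ⟨f, hf, hf1, e⟩ := h.alternating (m + m)
    rw [show m + 1 + (m + 1) = m + m + 1 + 1 by ring, e', e]
    nlinarith [mul_lt_mul_of_pos_right hf1 hp, mul_lt_one_of_nonneg_of_lt_one_left hg.le hg1 hf1.le,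
      mul_pos hg hf]

/-! ### Lattice coordinates and totally positive cones -/

variable {w : ℝ}

theorem one_le_conj (h : ConvergentRecurrence v X Y u) (hv : 0 < v) (hw : 1 < w) (n : ℕ) :
    1 ≤ (X n : ℝ) + Y n * w ∧ (X n : ℝ) + Y n * w ≤ X (n + 1) + Y (n + 1) * w := by
  induction n with
  | zero =>
    have : (0 : ℝ) ≤ ⌊v⌋ := by exact_mod_cast Int.floor_nonneg.2 hv.le
    simp only [h.X_zero, h.Y_zero, zero_add, h.X_one, h.Y_one]
    push_cast
    constructor <;> linarith
  | succ n ih =>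
    have hu : (1 : ℝ) ≤ u n := by exact_mod_cast h.u_pos n
    refine ⟨by linarith, ?_⟩
    rw [show n + 1 + 1 = n + 2 from rfl, h.X_rec, h.Y_rec]
    push_cast
    nlinarith

/-- Crude linear growth is enough: with `le_one_of_even` it sends the ratio of the two conjugates to
`0` along even indices. -/
theorem le_conj (h : ConvergentRecurrence v X Y u) (hv : 0 < v) (hw : 1 < w) (n : ℕ) :
    (n : ℝ) ≤ X (n + 1) + Y (n + 1) * w := by
  induction n with
  | zero => simpa using zero_le_one.trans (h.one_le_conj hv hw 1).1
  | succ n ih =>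
    have hu : (1 : ℝ) ≤ u n := by exact_mod_cast h.u_pos n
    have h1 := (h.one_le_conj hv hw n).1
    have h2 := (h.one_le_conj hv hw (n + 1)).1
    rw [show n + 1 + 1 = n + 2 from rfl, h.X_rec, h.Y_rec]
    push_cast
    nlinarith

/-- The coordinates of a totally positive element in the basis of the convergents number `n` and
`n + 1`, with `n` even, have a positive first entry. -/
theorem coord_pos (h : ConvergentRecurrence v X Y u) (hv : 0 < v) (hw : 1 < w) {n : ℕ}
    (hn : Even n) {s t : ℝ}
    (h1 : 0 < s * (X n + Y n * w) + t * (X (n + 1) + Y (n + 1) * w))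
    (h2 : 0 < s * (X n - Y n * v) + t * (X (n + 1) - Y (n + 1) * v)) : 0 < s := by
  have a1 := (h.one_le_conj hv hw n).1
  have a2 := (h.one_le_conj hv hw (n + 1)).1
  have d1 := h.pos_of_even hn
  have d2 := h.neg_of_even hn
  by_contra hs
  -- If `s ≤ 0`, then `t ≥ 0` makes the second form nonpositive, because its `t`-coefficient is
  -- negative, while `t ≤ 0` makes the first one nonpositive.
  push Not at hs
  rcases le_total 0 t with ht | ht
  · nlinarith [mul_nonneg_of_nonpos_of_nonpos hs (neg_nonpos.2 d1.le)]
  · nlinarith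

/-- An element of small absolute value under both embeddings is a multiple of a convergent. -/
theorem coord_eq_zero (h : ConvergentRecurrence v X Y u) (hv : 0 < v) (hw : 1 < w) {n : ℕ}
    (hn : Even n) {M l s t : ℤ} (hM : 1 ≤ M)
    (h1 : M * |s * (X n + Y n * w) + t * (X (n + 1) + Y (n + 1) * w)| <
      (X n + Y n * w) + l * (X (n + 1) + Y (n + 1) * w))
    (h2 : M * |s * (X n - Y n * v) + t * (X (n + 1) - Y (n + 1) * v)| <
      (X n - Y n * v) + l * (X (n + 1) - Y (n + 1) * v)) : s = 0 := by
  have hM0 : (0 : ℝ) ≤ M := by exact_mod_cast (by omega : 0 ≤ M)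
  have p1 := mul_le_mul_of_nonneg_left
    (le_abs_self (s * (X n + Y n * w) + t * (X (n + 1) + Y (n + 1) * w))) hM0
  have p2 := mul_le_mul_of_nonneg_left
    (neg_abs_le (s * (X n + Y n * w) + t * (X (n + 1) + Y (n + 1) * w))) hM0
  have q1 := mul_le_mul_of_nonneg_left
    (le_abs_self (s * (X n - Y n * v) + t * (X (n + 1) - Y (n + 1) * v))) hM0
  have q2 := mul_le_mul_of_nonneg_left
    (neg_abs_le (s * (X n - Y n * v) + t * (X (n + 1) - Y (n + 1) * v))) hM0
  -- With `α = α_n + l α_{n+1}`, both `α + Mκ` and `α - Mκ` are totally positive, so their first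
  -- coordinates `1 ± M s` are positive.
  have e1 : (0 : ℝ) < 1 + M * s :=
    h.coord_pos hv hw hn (t := l + M * t) (by linarith) (by linarith)
  have e2 : (0 : ℝ) < 1 - M * s :=
    h.coord_pos hv hw hn (t := l - M * t) (by linarith) (by linarith)
  have e1' : 0 < 1 + M * s := by exact_mod_cast e1
  have e2' : 0 < 1 - M * s := by exact_mod_cast e2
  rcases lt_trichotomy s 0 with hs | hs | hs
  · nlinarith
  · exact hs
  · nlinarith

/-- If both conjugates of an integer are smaller than those of a totally positive convergent, then it
is zero. -/
theorem eq_zero_of_abs_lt (h : ConvergentRecurrence v X Y u) (hv : 0 < v) (hw : 1 < w) {n : ℕ}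
    (hn : Even n) {c d : ℤ} (h1 : |c + d * w| < X n + Y n * w) (h2 : |c - d * v| < X n - Y n * v) :
    c = 0 ∧ d = 0 := by
  obtain ⟨s, t, rfl, rfl⟩ := h.exists_coords n c d
  have e1 : ((s * X n + t * X (n + 1) : ℤ) : ℝ) + ((s * Y n + t * Y (n + 1) : ℤ) : ℝ) * w =
      s * (X n + Y n * w) + t * (X (n + 1) + Y (n + 1) * w) := by push_cast; ring
  have e2 : ((s * X n + t * X (n + 1) : ℤ) : ℝ) - ((s * Y n + t * Y (n + 1) : ℤ) : ℝ) * v =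
      s * (X n - Y n * v) + t * (X (n + 1) - Y (n + 1) * v) := by push_cast; ring
  rw [e1] at h1
  rw [e2] at h2
  have hs : s = 0 := h.coord_eq_zero hv hw hn (M := 1) (l := 0) le_rfl
    (by push_cast; linarith) (by push_cast; linarith)
  subst hs
  have a1 := h.one_le_conj hv hw n
  have ht : t = 0 := by
    by_contra ht
    have ht1 : (1 : ℝ) ≤ |(t : ℝ)| := by exact_mod_cast Int.one_le_abs ht
    rw [Int.cast_zero, zero_mul, zero_add, abs_mul,
      abs_of_pos (by linarith : (0 : ℝ) < X (n + 1) + Y (n + 1) * w)] at h1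
    nlinarith
  subst ht
  simp

/-- A totally positive element lies in the cone of two consecutive totally positive convergents. -/
theorem exists_cone (h : ConvergentRecurrence v X Y u) (hv : 0 < v) (hw : 1 < w) {x y : ℝ}
    (hy : 0 < y) (hxy : y ≤ x) :
    ∃ n, Even n ∧ y * (X n + Y n * w) ≤ x * (X n - Y n * v) ∧
      x * (X (n + 2) - Y (n + 2) * v) < y * (X (n + 2) + Y (n + 2) * w) := by
  have hex : ∃ m : ℕ, x * (X (2 * m) - Y (2 * m) * v) < y * (X (2 * m) + Y (2 * m) * w) := by
    -- At index `2(N + 1)` one conjugate is at most `1` and the other at least `2N + 1`, while `x <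
    -- N y`. The least such index is then used; it is not `0`, since there both conjugates equal `1`
    -- and `y ≤ x`.
    obtain ⟨N, hN⟩ := exists_nat_gt (x / y)
    refine ⟨N + 1, ?_⟩
    have h1 := h.le_one_of_even (even_two_mul (N + 1))
    have h2 := h.le_conj hv hw (2 * N + 1)
    rw [show 2 * N + 1 + 1 = 2 * (N + 1) by ring] at h2
    push_cast at h2
    rw [div_lt_iff₀ hy] at hN
    have hNn : (0 : ℝ) ≤ N := Nat.cast_nonneg N
    nlinarith [mul_le_mul_of_nonneg_left h1 (hy.le.trans hxy), mul_le_mul_of_nonneg_left h2 hy.le,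
      mul_nonneg hNn hy.le]
  classical
  obtain ⟨m, hm⟩ : ∃ m, Nat.find hex = m + 1 := by
    apply Nat.exists_eq_succ_of_ne_zero
    intro h0
    have := Nat.find_spec hex
    rw [h0] at this
    simp [h.X_zero, h.Y_zero] at this
    linarith
  refine ⟨2 * m, even_two_mul m, ?_, ?_⟩
  · have := Nat.find_min hex (m := m) (by omega)
    exact not_lt.1 this
  · have := Nat.find_spec hex
    rwa [hm] at this

/-- The indecomposables with `α ≥ α'` are the upper and lower semiconvergents. -/
theorem exists_semiconvergent (h : ConvergentRecurrence v X Y u) (hv : 0 < v) (hw : 1 < w)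
    {a b : ℤ} (hx : 0 < a + b * w) (hy : 0 < a - b * v) (hxy : (a : ℝ) - b * v ≤ a + b * w)
    (hind : ∀ a₁ b₁ a₂ b₂ : ℤ, 0 < a₁ + b₁ * w → 0 < a₁ - b₁ * v → 0 < a₂ + b₂ * w →
      0 < a₂ - b₂ * v → a = a₁ + a₂ → b = b₁ + b₂ → False) :
    ∃ n, Even n ∧ ∃ l : ℤ, 0 ≤ l ∧ l ≤ u n ∧ a = X n + l * X (n + 1) ∧ b = Y n + l * Y (n + 1) := by
  obtain ⟨n, hn, hc1, hc2⟩ := h.exists_cone hv hw hy hxy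
  obtain ⟨s, t, ha, hb⟩ := h.exists_coords n a b
  have e1 : (a : ℝ) + b * w = s * (X n + Y n * w) + t * (X (n + 1) + Y (n + 1) * w) := by
    rw [ha, hb]; push_cast; ring
  have e2 : (a : ℝ) - b * v = s * (X n - Y n * v) + t * (X (n + 1) - Y (n + 1) * v) := by
    rw [ha, hb]; push_cast; ring
  have B0 := (h.one_le_conj hv hw n).1
  have B1 := (h.one_le_conj hv hw (n + 1)).1
  have D0 := h.pos_of_even hn
  have D1 := h.neg_of_even hn
  have D2 := h.pos_of_even (n := n + 2) (hn.add even_two)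
  have hu : (1 : ℝ) ≤ u n := by exact_mod_cast h.u_pos n
  have rB : (X (n + 2) : ℝ) + Y (n + 2) * w =
      u n * (X (n + 1) + Y (n + 1) * w) + (X n + Y n * w) := by
    rw [h.X_rec, h.Y_rec]; push_cast; ring
  have rD : (X (n + 2) : ℝ) - Y (n + 2) * v =
      u n * (X (n + 1) - Y (n + 1) * v) + (X n - Y n * v) := by
    rw [h.X_rec, h.Y_rec]; push_cast; ring
  -- The lattice points of the cone spanned by `α_n` and `α_{n+2} = α_n + u n * α_{n+1}` are totally
  -- positive.
  have semi_pos : ∀ m l : ℤ, 1 ≤ m → 0 ≤ l → l ≤ u n * m →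
      0 < ((m * X n + l * X (n + 1) : ℤ) : ℝ) + ((m * Y n + l * Y (n + 1) : ℤ) : ℝ) * w ∧
      0 < ((m * X n + l * X (n + 1) : ℤ) : ℝ) - ((m * Y n + l * Y (n + 1) : ℤ) : ℝ) * v := by
    intro m l hm hl hlm
    have hm' : (1 : ℝ) ≤ m := by exact_mod_cast hm
    have hl' : (0 : ℝ) ≤ l := by exact_mod_cast hl
    have hlm' : (l : ℝ) ≤ u n * m := by exact_mod_cast hlm
    rw [rD] at D2
    push_cast
    constructor
    · have k1 : 0 < (m : ℝ) * (X n + Y n * w) := by positivity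
      have k2 : 0 ≤ (l : ℝ) * (X (n + 1) + Y (n + 1) * w) := by positivity
      linarith
    · have k1 := mul_pos (by linarith : (0 : ℝ) < m) D2
      have k2 := mul_nonneg (sub_nonneg.2 hlm') (neg_nonneg.2 D1.le)
      linarith
  have hs : 0 < s := by
    have : (0 : ℝ) < s := h.coord_pos hv hw hn (t := t) (e1 ▸ hx) (e2 ▸ hy)
    exact_mod_cast this
  -- In coordinates the two cone inequalities are this determinant times `t` and times `u n * s -
  -- t`, so its sign gives `0 ≤ t < u n * s`.
  have hdet : 0 < (X (n + 1) + Y (n + 1) * w) * (X n - Y n * v) -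
      (X (n + 1) - Y (n + 1) * v) * (X n + Y n * w) := by
    nlinarith [mul_pos (by linarith : 0 < X (n + 1) + Y (n + 1) * w) D0,
      mul_pos (neg_pos.2 D1) (by linarith : 0 < X n + Y n * w)]
  have ht : 0 ≤ t := by
    have : (0 : ℝ) ≤ t * ((X (n + 1) + Y (n + 1) * w) * (X n - Y n * v) -
        (X (n + 1) - Y (n + 1) * v) * (X n + Y n * w)) := by
      rw [e1, e2] at hc1
      linarith
    have := nonneg_of_mul_nonneg_left this hdet
    exact_mod_cast this
  have htu : t < u n * s := by
    rw [e1, e2, rB, rD] at hc2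
    have : (0 : ℝ) < (u n * s - t) * ((X (n + 1) + Y (n + 1) * w) * (X n - Y n * v) -
        (X (n + 1) - Y (n + 1) * v) * (X n + Y n * w)) := by
      linarith
    have := pos_of_mul_pos_left this hdet.le
    have : (t : ℝ) < u n * s := by linarith
    exact_mod_cast this
  have hu' : (1 : ℤ) ≤ u n := by exact_mod_cast h.u_pos n
  rcases eq_or_lt_of_le (Int.add_one_le_iff.2 hs) with h1 | h1
  · have hs1 : s = 1 := by omega
    subst hs1
    refine ⟨n, hn, t, ht, by linarith, by rw [ha]; ring, by rw [hb]; ring⟩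
  · exfalso
    -- For `s ≥ 2` a summand with first coordinate `1` is split off. Taking as much of `t` as it
    -- allows leaves a remainder in the same cone, contradicting indecomposability.
    have hmin0 : 0 ≤ min t (u n) := le_min ht (by omega)
    have hmin1 : min t (u n : ℤ) ≤ u n := min_le_right _ _
    have hrest0 : 0 ≤ t - min t (u n) := sub_nonneg.2 (min_le_left _ _)
    have hrest1 : t - min t (u n) ≤ u n * (s - 1) := by
      rcases min_cases t (u n : ℤ) with ⟨e, -⟩ | ⟨e, -⟩
      · rw [e, sub_self]; nlinarith
      · rw [e]; linarith
    have P1 := semi_pos 1 (min t (u n)) le_rfl hmin0 (by linarith)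
    have P2 := semi_pos (s - 1) (t - min t (u n)) (by omega) hrest0 hrest1
    exact hind _ _ _ _ P1.1 P1.2 P2.1 P2.2 (by rw [ha]; ring) (by rw [hb]; ring)

/-- If `M` times both conjugates of an integer are smaller than those of a semiconvergent, where `M`
bounds the partial quotients of odd index, then it is zero. -/
theorem eq_zero_of_mul_abs_lt (h : ConvergentRecurrence v X Y u) (hv : 0 < v) (hw : 1 < w)
    {n : ℕ} (hn : Even n) {M : ℕ} (hM : u n ≤ M) {l c d : ℤ}
    (h1 : M * |c + d * w| < X n + l * X (n + 1) + (Y n + l * Y (n + 1)) * w)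
    (h2 : M * |c - d * v| < X n + l * X (n + 1) - (Y n + l * Y (n + 1)) * v) :
    c = 0 ∧ d = 0 := by
  obtain ⟨s, t, rfl, rfl⟩ := h.exists_coords n c d
  have e1 : ((s * X n + t * X (n + 1) : ℤ) : ℝ) + ((s * Y n + t * Y (n + 1) : ℤ) : ℝ) * w =
      s * (X n + Y n * w) + t * (X (n + 1) + Y (n + 1) * w) := by push_cast; ring
  have e2 : ((s * X n + t * X (n + 1) : ℤ) : ℝ) - ((s * Y n + t * Y (n + 1) : ℤ) : ℝ) * v =
      s * (X n - Y n * v) + t * (X (n + 1) - Y (n + 1) * v) := by push_cast; ring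
  rw [e1] at h1
  rw [e2] at h2
  have hM1 : 1 ≤ M := (h.u_pos n).trans hM
  have hs : s = 0 := h.coord_eq_zero hv hw hn (M := M) (l := l) (t := t) (by exact_mod_cast hM1)
    (by push_cast; linarith) (by push_cast; linarith)
  subst hs
  have a0 := (h.one_le_conj hv hw n).1
  have a1 := (h.one_le_conj hv hw n).2
  have D1 := h.neg_of_even hn
  have D2 := h.add_neg_of_even hn
  have rD : (X (n + 2) : ℝ) - Y (n + 2) * v =
      u n * (X (n + 1) - Y (n + 1) * v) + (X n - Y n * v) := by
    rw [h.X_rec, h.Y_rec]; push_cast; ring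
  have hB : (0 : ℝ) < X (n + 1) + Y (n + 1) * w := by linarith
  rw [Int.cast_zero, zero_mul, zero_add, abs_mul, abs_of_pos hB] at h1
  rw [Int.cast_zero, zero_mul, zero_add, abs_mul, abs_of_neg D1] at h2
  -- The first embedding uses `α_n ≤ α_{n+1}`. The second rewrites the conjugate of `α` as that of
  -- `α_{n+2}` plus `u n - l` times `|α_{n+1}'|`, where `α_{n+2}' < |α_{n+1}'|`. Over the integers
  -- the two bounds add up to `2M|t| ≤ u n ≤ M`.
  have g1 : (M : ℝ) * |(t : ℝ)| < l + 1 := by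
    by_contra hc
    push Not at hc
    nlinarith [mul_le_mul_of_nonneg_right hc hB.le]
  have g2 : (l : ℝ) + M * |(t : ℝ)| < u n + 1 := by
    by_contra hc
    push Not at hc
    rw [rD] at D2
    nlinarith [mul_le_mul_of_nonneg_right hc (neg_nonneg.2 D1.le)]
  have g1' : (M : ℤ) * |t| < l + 1 := by exact_mod_cast g1
  have g2' : l + (M : ℤ) * |t| < u n + 1 := by exact_mod_cast g2
  have ht : t = 0 := by
    by_contra ht
    have ht1 : 1 ≤ |t| := Int.one_le_abs ht
    have : (M : ℤ) ≤ M * |t| := by nlinarith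
    have : (u n : ℤ) ≤ M := by exact_mod_cast hM
    have : (1 : ℤ) ≤ M := by exact_mod_cast hM1
    omega
  subst ht
  simp

end ConvergentRecurrence

/-! ### Elements of small size in a real quadratic field -/

theorem one_lt_sqrt_natCast {k : ℕ} (h1 : 1 < k) : 1 < √(k : ℝ) := by
  rw [Real.lt_sqrt zero_le_one]
  simpa using h1

theorem one_lt_omega {k : ℕ} (h1 : 1 < k) : 1 < omega k := by
  have := one_lt_sqrt_natCast h1
  unfold omega
  split_ifs <;> linarith

theorem omegaConj_neg {k : ℕ} (h1 : 1 < k) : omegaConj k < 0 := by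
  have := one_lt_sqrt_natCast h1
  unfold omegaConj
  split_ifs <;> linarith

/-- `c + d ω_k` and its conjugate exceed `0`. -/
def PosPair (k : ℕ) (c d : ℤ) : Prop :=
  0 < c + d * omega k ∧ 0 < c + d * omegaConj k

/-- `a + b ω_k` is indecomposable in the ring of integers of `ℚ(√k)`, in terms of coordinates. -/
def IndecomposablePair (k : ℕ) (a b : ℤ) : Prop :=
  PosPair k a b ∧ ∀ a₁ b₁ a₂ b₂ : ℤ, PosPair k a₁ b₁ → PosPair k a₂ b₂ →
    a = a₁ + a₂ → b = b₁ + b₂ → False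

/-- No nonzero integer of `ℚ(√k)` becomes smaller than `a + b ω_k` under both embeddings after
multiplication by `N`. -/
def Rigid (N k : ℕ) (a b : ℤ) : Prop :=
  ∀ c d : ℤ, N * |c + d * omega k| < a + b * omega k →
    N * |c + d * omegaConj k| < a + b * omegaConj k → c = 0 ∧ d = 0

/-- The integer `t` such that `ω + ω' = t`. -/
def omegaTrace (k : ℕ) : ℤ := if k % 4 = 1 then 1 else 0

theorem omega_add_omegaConj (k : ℕ) : omega k + omegaConj k = omegaTrace k := by
  unfold omega omegaConj omegaTrace
  split_ifs <;> push_cast <;> ring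

theorem add_mul_omega_conj (k : ℕ) (c d : ℤ) :
    (c : ℝ) + d * omegaConj k = (c + d * omegaTrace k : ℤ) + (-d : ℤ) * omega k := by
  push_cast
  linear_combination (d : ℝ) * omega_add_omegaConj k

theorem add_mul_omegaConj_conj (k : ℕ) (c d : ℤ) :
    (c : ℝ) + d * omega k = (c + d * omegaTrace k : ℤ) + (-d : ℤ) * omegaConj k := by
  push_cast
  linear_combination (d : ℝ) * omega_add_omegaConj k

theorem posPair_conj {k : ℕ} {c d : ℤ} :
    PosPair k (c + d * omegaTrace k) (-d) ↔ PosPair k c d := by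
  unfold PosPair
  rw [← add_mul_omega_conj, ← add_mul_omegaConj_conj, and_comm]

/-- Semiconvergents account only for indecomposables that are at least their conjugate; this lemma
and `Rigid.of_conj` reduce the others to them. -/
theorem IndecomposablePair.conj {k : ℕ} {a b : ℤ} (h : IndecomposablePair k a b) :
    IndecomposablePair k (a + b * omegaTrace k) (-b) := by
  refine ⟨posPair_conj.2 h.1, fun a₁ b₁ a₂ b₂ h1 h2 ha hb => ?_⟩
  refine h.2 _ _ _ _ (posPair_conj.2 h1) (posPair_conj.2 h2) ?_ (by linarith)
  have : b = -b₁ + -b₂ := by linarith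
  rw [this] at ha
  linarith

theorem Rigid.of_conj {N k : ℕ} {a b : ℤ} (h : Rigid N k (a + b * omegaTrace k) (-b)) :
    Rigid N k a b := by
  intro c d h1 h2
  have := h (c + d * omegaTrace k) (-d)
    (by rwa [← add_mul_omega_conj, ← add_mul_omega_conj])
    (by rwa [← add_mul_omegaConj_conj, ← add_mul_omegaConj_conj])
  have hd : d = 0 := by omega
  subst hd
  simpa using this

theorem exists_convergentRecurrence_omega {k : ℕ} (hk : Squarefree k) (h1 : 1 < k) :
    ∃ (X Y : ℕ → ℤ) (u : ℕ → ℕ), ConvergentRecurrence (-omegaConj k) X Y u ∧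
      (∀ n, (contFrac k).nums n = X (n + 1) ∧ (contFrac k).dens n = Y (n + 1)) ∧
      ∀ n, Even n → u n ≤ maxOddQuotient k := by
  obtain ⟨X, Y, u, h, hXY, hu⟩ := exists_convergentRecurrence (irrational_neg_omegaConj hk h1)
  refine ⟨X, Y, u, h, fun n => ?_, fun n hn => ?_⟩
  · rw [GenContFract.num_eq_conts_a, GenContFract.den_eq_conts_b,
      GenContFract.nth_cont_eq_succ_nth_contAux, contFrac, hXY]
    exact ⟨rfl, rfl⟩
  -- `u n` is the partial quotient of index `n + 1`, so even `n` here means odd index in the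
  -- definition of `M_k`.
  · exact (isGreatest_maxOddQuotient hk h1).2 ⟨n + 1, hn.add_one, hu n⟩

theorem rigid_one_of_isConvergent {k : ℕ} (hk : Squarefree k) (h1 : 1 < k) {a b : ℤ}
    (hpos : PosPair k a b) (hc : IsConvergent k (a + b * omega k)) : Rigid 1 k a b := by
  obtain ⟨X, Y, u, h, hXY, -⟩ := exists_convergentRecurrence_omega hk h1
  obtain ⟨i, hi⟩ := hc
  rw [(hXY i).1, (hXY i).2] at hi
  have hirr : Irrational (omega k) := by
    have : omega k = (omegaTrace k : ℝ) + -omegaConj k := by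
      linarith [omega_add_omegaConj k]
    rw [this]
    exact (irrational_neg_omegaConj hk h1).intCast_add _
  have hb : b = Y (i + 1) := by
    by_contra hne
    have hne' : (b : ℝ) - Y (i + 1) ≠ 0 := by
      rw [sub_ne_zero]; exact_mod_cast hne
    apply hirr
    refine ⟨((X (i + 1) - a : ℤ) : ℚ) / ((b - Y (i + 1) : ℤ) : ℚ), ?_⟩
    push_cast
    rw [div_eq_iff hne']
    linarith
  have ha : a = X (i + 1) := by
    rw [hb] at hi
    exact_mod_cast add_right_cancel hi
  have hv : 0 < -omegaConj k := by linarith [omegaConj_neg h1]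
  subst ha hb
  -- Total positivity singles out the convergents on the right side of `v`.
  have heven : Even (i + 1) := h.even_of_pos (by linarith [hpos.2])
  intro c d g1 g2
  rw [Nat.cast_one, one_mul] at g1 g2
  exact h.eq_zero_of_abs_lt hv (one_lt_omega h1) heven g1
    (by rw [mul_neg, sub_neg_eq_add, mul_neg, sub_neg_eq_add]; exact g2)

theorem rigid_maxOddQuotient {k : ℕ} (hk : Squarefree k) (h1 : 1 < k) {a b : ℤ}
    (hind : IndecomposablePair k a b) : Rigid (maxOddQuotient k) k a b := by
  obtain ⟨X, Y, u, h, -, hu⟩ := exists_convergentRecurrence_omega hk h1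
  have hv : 0 < -omegaConj k := by linarith [omegaConj_neg h1]
  have key : ∀ a b : ℤ, IndecomposablePair k a b →
      (a : ℝ) + b * omegaConj k ≤ a + b * omega k → Rigid (maxOddQuotient k) k a b := by
    intro a b hind hle c d g1 g2
    have conv : ∀ x y : ℝ, x - y * -omegaConj k = x + y * omegaConj k := fun x y => by ring
    obtain ⟨n, hn, l, hl0, hlu, rfl, rfl⟩ := h.exists_semiconvergent hv (one_lt_omega h1)
      hind.1.1 (by rw [conv]; exact hind.1.2) (by rw [conv]; exact hle)
      (fun a₁ b₁ a₂ b₂ p1 p2 p3 p4 => by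
        rw [conv] at p2 p4
        exact hind.2 _ _ _ _ ⟨p1, p2⟩ ⟨p3, p4⟩)
    push_cast at g1 g2
    exact h.eq_zero_of_mul_abs_lt hv (one_lt_omega h1) hn (hu n hn) (l := l) g1
      (by rw [conv, conv]; exact g2)
  rcases le_total ((a : ℝ) + b * omegaConj k) (a + b * omega k) with hle | hle
  · exact key a b hind hle
  · refine (key _ _ hind.conj ?_).of_conj
    rwa [← add_mul_omega_conj, ← add_mul_omegaConj_conj]

/-! ### Embeddings -/

/-- If `s ^ 2 ∈ F` and `s ∉ F`, then `F(s)` has an embedding that fixes `F` and maps `s` to `-s`. -/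
theorem exists_embedding_neg (F K : IntermediateField ℚ ℝ) {s : ℝ} (hs : s ∉ F) (hs2 : s ^ 2 ∈ F)
    (hK : K ≤ F ⊔ IntermediateField.adjoin ℚ {s}) :
    ∃ σ : K →+* ℂ, (∀ x : K, (x : ℝ) ∈ F → σ x = ((x : ℝ) : ℂ)) ∧
      ∀ x : K, (x : ℝ) = s → σ x = ((-s : ℝ) : ℂ) := by
  have hroot : Polynomial.aeval s (Polynomial.X ^ 2 - Polynomial.C (⟨s ^ 2, hs2⟩ : F)) = 0 := by
    simp [IntermediateField.algebraMap_apply]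
  have hmonic : (Polynomial.X ^ 2 - Polynomial.C (⟨s ^ 2, hs2⟩ : F)).Monic :=
    Polynomial.monic_X_pow_sub_C _ two_ne_zero
  have hirr : Irreducible (Polynomial.X ^ 2 - Polynomial.C (⟨s ^ 2, hs2⟩ : F)) := by
    rw [X_pow_sub_C_irreducible_iff_of_prime Nat.prime_two]
    intro b hb
    have hb' : (b : ℝ) ^ 2 = s ^ 2 := congrArg Subtype.val hb
    rcases sq_eq_sq_iff_eq_or_eq_neg.1 hb' with h | h
    · exact hs (h ▸ b.2)
    · exact hs (by rw [show s = -(b : ℝ) by linarith]; exact neg_mem b.2)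
  have hmin := minpoly.eq_of_irreducible_of_monic hirr hroot hmonic
  have hint : IsIntegral F s := ⟨_, hmonic, by rwa [← Polynomial.aeval_def]⟩
  obtain ⟨φ, hφ⟩ := IntermediateField.exists_algHom_adjoin_of_splits_of_aeval (F := F) (E := ℝ)
    (K := ℂ) (S := {s}) (fun t ht => by
      rw [Set.mem_singleton_iff.1 ht]
      exact ⟨hint, IsAlgClosed.splits _⟩)
    (x := s) (y := ((-s : ℝ) : ℂ)) (IntermediateField.mem_adjoin_simple_self F s) (by
      rw [← hmin]
      have : algebraMap F ℂ ⟨s ^ 2, hs2⟩ = ((s ^ 2 : ℝ) : ℂ) := rfl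
      simp [this])
  have hle : ∀ x : ℝ, x ∈ K → x ∈ IntermediateField.adjoin F {s} := by
    have : K ≤ (IntermediateField.adjoin F {s}).restrictScalars ℚ := by
      refine hK.trans (sup_le ?_ ?_)
      · intro x hx
        exact (IntermediateField.adjoin F {s}).algebraMap_mem ⟨x, hx⟩
      · rw [IntermediateField.adjoin_le_iff, Set.singleton_subset_iff]
        exact IntermediateField.mem_adjoin_simple_self F s
    exact fun x hx => this hx
  let ι : K →+* IntermediateField.adjoin F {s} :=
    (algebraMap K ℝ).codRestrict (IntermediateField.adjoin F {s}) (fun x => hle x x.2)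
  refine ⟨(φ : IntermediateField.adjoin F {s} →+* ℂ).comp ι, fun x hx => ?_, fun x hx => ?_⟩
  · have : ι x = algebraMap F (IntermediateField.adjoin F {s}) ⟨x, hx⟩ := rfl
    rw [RingHom.comp_apply, this]
    exact φ.commutes _
  · rw [← hφ, RingHom.comp_apply]
    exact congrArg φ (Subtype.ext hx)

theorem isIntegral_coe_iff {K : IntermediateField ℚ ℝ} {x : K} :
    IsIntegral ℤ (x : ℝ) ↔ IsIntegral ℤ x :=
  isIntegral_algebraMap_iff (A := K) (B := ℝ) Subtype.val_injective

theorem isIntegral_of_embedding {K : IntermediateField ℚ ℝ} (σ : K →+* ℂ) {x : K} {y : ℝ}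
    (h : σ x = (y : ℂ)) (hx : IsIntegral ℤ x) : IsIntegral ℤ y := by
  have := map_isIntegral_int σ hx
  rw [h] at this
  exact (isIntegral_algebraMap_iff (A := ℝ) (B := ℂ) Complex.ofReal_injective).1 this

theorem exists_int_of_isIntegral {s : ℚ} (h : IsIntegral ℤ (s : ℝ)) : ∃ m : ℤ, s = m := by
  have h' : IsIntegral ℤ s :=
    (isIntegral_algebraMap_iff (A := ℚ) (B := ℝ) (algebraMap ℚ ℝ).injective).1 h
  obtain ⟨m, hm⟩ := IsIntegrallyClosed.isIntegral_iff.1 h'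
  exact ⟨m, by rw [← hm]; simp⟩

/-! ### The quadratic field -/

theorem sqrt_mem_quadraticField (k : ℕ) : √(k : ℝ) ∈ quadraticField k :=
  IntermediateField.mem_adjoin_simple_self ℚ _

theorem isIntegral_sqrt (k : ℕ) : IsIntegral ℤ √(k : ℝ) := by
  refine ⟨Polynomial.X ^ 2 - Polynomial.C (k : ℤ), Polynomial.monic_X_pow_sub_C _ two_ne_zero, ?_⟩
  simp

theorem isAlgebraic_sqrt (k : ℕ) : IsAlgebraic ℚ √(k : ℝ) :=
  ((isIntegral_sqrt k).tower_top (A := ℚ)).isAlgebraic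

theorem exists_coords_quadraticField {k : ℕ} {x : ℝ} (hx : x ∈ quadraticField k) :
    ∃ s t : ℚ, x = s + t * √(k : ℝ) := by
  have hs : √(k : ℝ) * √(k : ℝ) = k := Real.mul_self_sqrt (Nat.cast_nonneg k)
  rw [quadraticField, ← IntermediateField.mem_toSubalgebra,
    IntermediateField.adjoin_toSubalgebra_of_isAlgebraic (by
      rintro y rfl; exact isAlgebraic_sqrt k)] at hx
  induction hx using Algebra.adjoin_induction with
  | mem y hy => exact ⟨0, 1, by rw [Set.mem_singleton_iff.1 hy]; simp⟩
  | algebraMap c => exact ⟨c, 0, by simp⟩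
  | add y z _ _ hy hz =>
    obtain ⟨s, t, rfl⟩ := hy
    obtain ⟨s', t', rfl⟩ := hz
    exact ⟨s + s', t + t', by push_cast; ring⟩
  | mul y z _ _ hy hz =>
    obtain ⟨s, t, rfl⟩ := hy
    obtain ⟨s', t', rfl⟩ := hz
    exact ⟨s * s' + t * t' * k, s * t' + t * s', by
      push_cast; linear_combination (t * t' : ℝ) * hs⟩

theorem embedding_eq {K : IntermediateField ℚ ℝ} (σ : K →+* ℂ) {w x : K} {w' : ℝ}
    (hw : σ w = (w' : ℂ)) {s t : ℚ} (hx : (x : ℝ) = s + t * (w : ℝ)) :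
    σ x = ((s + t * w' : ℝ) : ℂ) := by
  have : x = (s : K) + (t : K) * w := Subtype.ext (by rw [hx]; simp)
  rw [this, map_add, map_mul, map_ratCast, map_ratCast, hw]
  push_cast
  rfl

theorem totallyPositive_of_quadratic {K : IntermediateField ℚ ℝ} {k : ℕ}
    (hK : √(k : ℝ) ∈ K) {x : K} {s t : ℚ} (hx : (x : ℝ) = s + t * √(k : ℝ))
    (h1 : 0 < s + t * √(k : ℝ)) (h2 : 0 < s - t * √(k : ℝ)) : TotallyPositive x := by
  intro σ
  have hsq : σ ⟨√(k : ℝ), hK⟩ ^ 2 = ((√(k : ℝ) : ℝ) : ℂ) ^ 2 := by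
    have h : (⟨√(k : ℝ), hK⟩ : K) ^ 2 = (k : K) := Subtype.ext (by simp)
    rw [← map_pow, h, map_natCast, ← Complex.ofReal_pow, Real.sq_sqrt (Nat.cast_nonneg k)]
    simp
  rcases sq_eq_sq_iff_eq_or_eq_neg.1 hsq with h | h
  · rw [embedding_eq σ h hx]
    exact Complex.zero_lt_real.2 h1
  · rw [← Complex.ofReal_neg] at h
    rw [embedding_eq σ h hx]
    exact Complex.zero_lt_real.2 (by linarith)

theorem exists_conj_embedding {k : ℕ} (hk : Squarefree k) (h1 : 1 < k) :
    ∃ σ : quadraticField k →+* ℂ, ∀ (x : quadraticField k) (s t : ℚ),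
      (x : ℝ) = s + t * √(k : ℝ) → σ x = ((s - t * √(k : ℝ) : ℝ) : ℂ) := by
  obtain ⟨σ, -, hσ⟩ := exists_embedding_neg ⊥ (quadraticField k) (s := √(k : ℝ))
    (by
      rw [IntermediateField.mem_bot]
      rintro ⟨a, ha⟩
      exact irrational_sqrt_of_squarefree hk h1 ⟨a, ha⟩)
    (by
      rw [Real.sq_sqrt (Nat.cast_nonneg k)]
      exact natCast_mem _ k)
    le_sup_right
  refine ⟨σ, fun x s t hx => ?_⟩
  rw [embedding_eq σ (hσ ⟨_, sqrt_mem_quadraticField k⟩ rfl) hx]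
  congr 1
  ring

/-- Half-integer coordinates `m / 2 + n / 2 * √k` of an integer of `ℚ(√k)`. -/
def HalfIntegral (k : ℕ) (m n : ℤ) : Prop :=
  (m - n) % 2 = 0 ∧ (k % 4 ≠ 1 → m % 2 = 0 ∧ n % 2 = 0)

/-- The trace `2s` and the norm are integers, so `k(2t)²` is one too, and squarefreeness makes `2t`
integral. The parities then follow from `m² ≡ k n²` modulo `4`. -/
theorem exists_halfIntegral {k : ℕ} (hk : Squarefree k) (h1 : 1 < k) {s t : ℚ}
    (h : IsIntegral ℤ (s + t * √(k : ℝ))) :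
    ∃ m n : ℤ, 2 * s = m ∧ 2 * t = n ∧ HalfIntegral k m n := by
  have hsq : √(k : ℝ) * √(k : ℝ) = k := Real.mul_self_sqrt (Nat.cast_nonneg k)
  have hmem : (s + t * √(k : ℝ)) ∈ quadraticField k :=
    add_mem (SubfieldClass.ratCast_mem _ s)
      (mul_mem (SubfieldClass.ratCast_mem _ t) (sqrt_mem_quadraticField k))
  obtain ⟨σ, hσ⟩ := exists_conj_embedding hk h1
  have hc : IsIntegral ℤ (s - t * √(k : ℝ)) :=
    isIntegral_of_embedding σ (hσ ⟨_, hmem⟩ s t rfl) (isIntegral_coe_iff.1 h)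
  obtain ⟨m, hm⟩ := exists_int_of_isIntegral (s := 2 * s) (by
    have := h.add hc
    rwa [show (s + t * √(k : ℝ)) + (s - t * √(k : ℝ)) = ((2 * s : ℚ) : ℝ) by push_cast; ring]
      at this)
  obtain ⟨N, hN⟩ := exists_int_of_isIntegral (s := s ^ 2 - k * t ^ 2) (by
    have := h.mul hc
    rwa [show (s + t * √(k : ℝ)) * (s - t * √(k : ℝ)) = ((s ^ 2 - k * t ^ 2 : ℚ) : ℝ) by
      push_cast; linear_combination (-(t : ℝ) ^ 2) * hsq] at this)
  have hkt : (k : ℚ) * (2 * t) ^ 2 = (m ^ 2 - 4 * N : ℤ) := by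
    push_cast; rw [← hm, ← hN]; ring
  obtain ⟨n, hn⟩ : ∃ n : ℤ, 2 * t = n := by
    have hden : ((2 * t).den : ℤ) * (2 * t).den ∣ k := by
      have e : (k : ℤ) * (2 * t).num ^ 2 = (m ^ 2 - 4 * N) * ((2 * t).den * (2 * t).den) := by
        have hd : ((2 * t).den : ℚ) ≠ 0 := by exact_mod_cast (2 * t).den_ne_zero
        have := hkt
        rw [← Rat.num_div_den (2 * t), div_pow, ← mul_div_assoc,
          div_eq_iff (pow_ne_zero 2 hd)] at this
        have e' : (k : ℚ) * (2 * t).num ^ 2 = (m ^ 2 - 4 * N : ℤ) * ((2 * t).den * (2 * t).den) := by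
          rw [this]; ring
        exact_mod_cast e'
      have hcop : IsCoprime (((2 * t).den : ℤ) * (2 * t).den) ((2 * t).num ^ 2) := by
        have := (Rat.isCoprime_num_den (2 * t)).symm
        exact (this.mul_left this).pow_right
      exact hcop.dvd_of_dvd_mul_right ⟨m ^ 2 - 4 * N, by rw [e]; ring⟩
    have hden' : (2 * t).den * (2 * t).den ∣ k := by exact_mod_cast hden
    have h1 := Nat.isUnit_iff.1 (hk _ hden')
    exact ⟨(2 * t).num, ((2 * t).den_eq_one_iff.1 h1).symm⟩
  refine ⟨m, n, hm, hn, ?_⟩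
  have hZ : m ^ 2 - k * n ^ 2 = 4 * N := by
    rw [hn] at hkt
    have : (k : ℤ) * n ^ 2 = m ^ 2 - 4 * N := by exact_mod_cast hkt
    linarith
  have hk4 : k % 4 ≠ 0 := by
    intro h0
    have := Nat.isUnit_iff.1 (hk 2 (by omega))
    omega
  have mod4 : ∀ i : ℤ, i % 2 = 0 ∧ i ^ 2 % 4 = 0 ∨ i % 2 = 1 ∧ i ^ 2 % 4 = 1 := by
    intro i
    rcases Int.even_or_odd' i with ⟨j, rfl | rfl⟩
    · left; ring_nf; omega
    · right; ring_nf; omega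
  obtain ⟨j, hj⟩ : ∃ j : ℤ, (k : ℤ) = 4 * j + (k % 4 : ℕ) := ⟨k / 4, by omega⟩
  unfold HalfIntegral
  have hlt : k % 4 < 4 := Nat.mod_lt _ (by norm_num)
  have hm4 := mod4 m
  have hn4 := mod4 n
  rw [hj] at hZ
  have hZ' : m ^ 2 - ((k % 4 : ℕ) : ℤ) * n ^ 2 = 4 * (N + j * n ^ 2) := by linear_combination hZ
  -- Only the residues of the squares matter, so they become opaque and the remaining problem is
  -- linear.
  generalize m ^ 2 = m2 at *
  generalize n ^ 2 = n2 at *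
  generalize j * n2 = jn at *
  generalize k % 4 = e at *
  interval_cases e <;> omega

theorem exists_omega_coords {k : ℕ} {m n : ℤ} (h : HalfIntegral k m n) :
    ∃ c d : ℤ, (c : ℝ) + d * omega k = m / 2 + n / 2 * √(k : ℝ) ∧
      (c : ℝ) + d * omegaConj k = m / 2 - n / 2 * √(k : ℝ) := by
  obtain ⟨h1, h2⟩ := h
  unfold omega omegaConj
  split_ifs with hk
  · obtain ⟨c, hc⟩ : ∃ c, m = n + 2 * c := ⟨(m - n) / 2, by omega⟩
    refine ⟨c, n, ?_, ?_⟩ <;> rw [hc] <;> push_cast <;> ring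
  · obtain ⟨hm, hn⟩ := h2 hk
    obtain ⟨c, hc⟩ : ∃ c, m = 2 * c := ⟨m / 2, by omega⟩
    obtain ⟨d, hd⟩ : ∃ d, n = 2 * d := ⟨n / 2, by omega⟩
    refine ⟨c, d, ?_, ?_⟩ <;> rw [hc, hd] <;> push_cast <;> ring

theorem exists_sqrt_coords (k : ℕ) (c d : ℤ) :
    ∃ s t : ℚ, (c : ℝ) + d * omega k = s + t * √(k : ℝ) ∧
      (c : ℝ) + d * omegaConj k = s - t * √(k : ℝ) := by
  unfold omega omegaConj
  split_ifs
  · exact ⟨c + d / 2, d / 2, by push_cast; ring, by push_cast; ring⟩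
  · exact ⟨c, d, by push_cast; ring, by push_cast; ring⟩

theorem isIntegral_omega (k : ℕ) : IsIntegral ℤ (omega k) := by
  obtain ⟨t, m, ht, hm⟩ := exists_int_trace_norm k
  refine ⟨Polynomial.X ^ 2 + (Polynomial.C t * Polynomial.X + Polynomial.C m), ?_, ?_⟩
  · exact Polynomial.monic_X_pow_add (by compute_degree!)
  · simp only [Polynomial.eval₂_add, Polynomial.eval₂_pow, Polynomial.eval₂_X,
      Polynomial.eval₂_mul, Polynomial.eval₂_C]
    rw [eq_intCast, eq_intCast, ← ht, ← hm]
    ring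

theorem isIntegral_add_mul_omega (k : ℕ) (c d : ℤ) : IsIntegral ℤ ((c : ℝ) + d * omega k) :=
  (isIntegral_algebraMap (R := ℤ) (x := c)).add
    ((isIntegral_algebraMap (R := ℤ) (x := d)).mul (isIntegral_omega k))

theorem add_mul_omega_mem {K : IntermediateField ℚ ℝ} {k : ℕ} (hK : √(k : ℝ) ∈ K) (c d : ℤ) :
    (c : ℝ) + d * omega k ∈ K := by
  obtain ⟨s, t, h, -⟩ := exists_sqrt_coords k c d
  rw [h]
  exact add_mem (SubfieldClass.ratCast_mem _ s) (mul_mem (SubfieldClass.ratCast_mem _ t) hK)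

/-- The integer `c + d ω_k` of a field that contains `√k`. -/
def integerOf {K : IntermediateField ℚ ℝ} {k : ℕ} (hK : √(k : ℝ) ∈ K) (c d : ℤ) : 𝓞 K :=
  ⟨⟨(c : ℝ) + d * omega k, add_mul_omega_mem hK c d⟩,
    isIntegral_coe_iff.1 (isIntegral_add_mul_omega k c d)⟩

theorem coe_integerOf {K : IntermediateField ℚ ℝ} {k : ℕ} (hK : √(k : ℝ) ∈ K) (c d : ℤ) :
    ((integerOf hK c d : K) : ℝ) = c + d * omega k := rfl

theorem totallyPositive_integerOf {K : IntermediateField ℚ ℝ} {k : ℕ} (hK : √(k : ℝ) ∈ K)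
    {c d : ℤ} (h : PosPair k c d) : TotallyPositive (integerOf hK c d : K) := by
  obtain ⟨s, t, e, e'⟩ := exists_sqrt_coords k c d
  refine totallyPositive_of_quadratic hK (s := s) (t := t) (by rw [coe_integerOf, e]) ?_ ?_
  · rw [← e]; exact h.1
  · rw [← e']; exact h.2

theorem exists_indecomposablePair {k : ℕ} (hk : Squarefree k) (h1 : 1 < k) {α : ℝ}
    (h : IndecomposableIn (quadraticField k) α) :
    ∃ a b : ℤ, α = a + b * omega k ∧ IndecomposablePair k a b := by
  obtain ⟨x, hx, hpos, hdec⟩ := h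
  obtain ⟨s, t, hst⟩ := exists_coords_quadraticField (x : quadraticField k).2
  have hint : IsIntegral ℤ (s + t * √(k : ℝ)) := by
    rw [← hst]
    exact isIntegral_coe_iff.2 (NumberField.RingOfIntegers.isIntegral_coe x)
  obtain ⟨m, n, hm, hn, hmn⟩ := exists_halfIntegral hk h1 hint
  obtain ⟨a, b, e, e'⟩ := exists_omega_coords hmn
  have hs : (s : ℝ) = m / 2 := by
    have : (2 * s : ℝ) = m := by exact_mod_cast hm
    linarith
  have ht : (t : ℝ) = n / 2 := by
    have : (2 * t : ℝ) = n := by exact_mod_cast hn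
    linarith
  rw [← hs, ← ht] at e e'
  have hα : α = a + b * omega k := by rw [← hx, hst, e]
  refine ⟨a, b, hα, ⟨?_, ?_⟩, ?_⟩
  · rw [e, ← hst]
    exact Complex.zero_lt_real.1 (hpos (Complex.ofRealHom.comp (algebraMap _ ℝ)))
  · obtain ⟨σ, hσ⟩ := exists_conj_embedding hk h1
    have := hpos σ
    rw [hσ _ s t hst] at this
    rw [e']
    exact Complex.zero_lt_real.1 this
  · intro a₁ b₁ a₂ b₂ p1 p2 ha hb
    refine hdec ⟨_, _, totallyPositive_integerOf (sqrt_mem_quadraticField k) p1,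
      totallyPositive_integerOf (sqrt_mem_quadraticField k) p2, ?_⟩
    apply NumberField.RingOfIntegers.ext
    apply Subtype.ext
    change ((x : quadraticField k) : ℝ) = (a₁ + b₁ * omega k) + (a₂ + b₂ * omega k)
    rw [hx, hα, ha, hb]
    push_cast
    ring

/-! ### The biquadratic field -/

/-- `p = a b`, `q = a c` and `r = b c` are the squarefree integers such that `√p`, `√q` and `√r`
generate the quadratic subfields of a biquadratic field. -/
structure BiquadTriple (p q r a b c : ℕ) : Prop where
  p_eq : p = a * b
  q_eq : q = a * c
  r_eq : r = b * c
  sqf_p : Squarefree p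
  sqf_q : Squarefree q
  sqf_r : Squarefree r
  one_lt_p : 1 < p
  one_lt_q : 1 < q
  one_lt_r : 1 < r

theorem exists_biquadTriple {p q r : ℕ} (hp : Squarefree p) (hq : Squarefree q)
    (hp1 : 1 < p) (hq1 : 1 < q) (hpq : p ≠ q) (hr : r = p * q / Nat.gcd p q ^ 2) :
    ∃ a b c, BiquadTriple p q r a b c := by
  obtain ⟨b, hb⟩ := Nat.gcd_dvd_left p q
  obtain ⟨c, hc⟩ := Nat.gcd_dvd_right p q
  have hg : 0 < Nat.gcd p q := Nat.gcd_pos_of_pos_left _ (by omega)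
  have hcop : Nat.Coprime b c := by
    have h := Nat.gcd_mul_left (Nat.gcd p q) b c
    rw [← hb, ← hc] at h
    exact Nat.eq_of_mul_eq_mul_left hg (by rw [← h, mul_one])
  have hr' : r = b * c := by
    have e : p * q = Nat.gcd p q ^ 2 * (b * c) :=
      (congrArg₂ (· * ·) hb hc).trans (by ring)
    rw [hr, e, Nat.mul_div_cancel_left _ (by positivity)]
  have hsb : Squarefree b := (hb ▸ hp).of_mul_right
  have hsc : Squarefree c := (hc ▸ hq).of_mul_right
  refine ⟨Nat.gcd p q, b, c, hb, hc, hr', hp, hq, ?_, hp1, hq1, ?_⟩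
  · rw [hr']; exact Nat.squarefree_mul_iff.2 ⟨hcop, hsb, hsc⟩
  · have hb0 : b ≠ 0 := hsb.ne_zero
    have hc0 : c ≠ 0 := hsc.ne_zero
    rw [hr']
    by_contra hle
    have : b * c = 1 := by
      have : 0 < b * c := by positivity
      omega
    have hb1 := Nat.eq_one_of_mul_eq_one_right this
    have hc1 := Nat.eq_one_of_mul_eq_one_left this
    rw [hb1] at hb
    rw [hc1] at hc
    exact hpq (hb.trans hc.symm)

theorem biquadraticField_comm (p q : ℕ) :
    biquadraticField p q = biquadraticField q p := by
  rw [biquadraticField, biquadraticField, Set.pair_comm]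

theorem sqrt_p_mem (p q : ℕ) : √(p : ℝ) ∈ biquadraticField p q :=
  IntermediateField.subset_adjoin ℚ _ (Set.mem_insert _ _)

theorem sqrt_q_mem (p q : ℕ) : √(q : ℝ) ∈ biquadraticField p q :=
  IntermediateField.subset_adjoin ℚ _ (Set.mem_insert_of_mem _ rfl)

namespace BiquadTriple

variable {p q r a b c : ℕ}

theorem swap_pq (T : BiquadTriple p q r a b c) : BiquadTriple q p r a c b :=
  ⟨T.q_eq, T.p_eq, by rw [T.r_eq, mul_comm], T.sqf_q, T.sqf_p, T.sqf_r, T.one_lt_q, T.one_lt_p,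
    T.one_lt_r⟩

theorem swap_qr (T : BiquadTriple p q r a b c) : BiquadTriple p r q b a c :=
  ⟨by rw [T.p_eq, mul_comm], T.r_eq, T.q_eq, T.sqf_p, T.sqf_r, T.sqf_q, T.one_lt_p, T.one_lt_r,
    T.one_lt_q⟩

theorem a_pos (T : BiquadTriple p q r a b c) : 0 < a := by
  have h := T.one_lt_p
  rw [T.p_eq] at h
  exact Nat.pos_of_ne_zero (by rintro rfl; simp at h)

theorem sqrt_mul_sqrt (T : BiquadTriple p q r a b c) :
    √(p : ℝ) * √(q : ℝ) = a * √(r : ℝ) := by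
  rw [← Real.sqrt_mul (Nat.cast_nonneg p), T.p_eq, T.q_eq, T.r_eq]
  push_cast
  rw [show (a * b * (a * c) : ℝ) = a ^ 2 * (b * c) by ring, Real.sqrt_mul (by positivity),
    Real.sqrt_sq (Nat.cast_nonneg a)]

theorem biquadraticField_le (T : BiquadTriple p q r a b c) :
    biquadraticField p r ≤ biquadraticField p q := by
  rw [biquadraticField, IntermediateField.adjoin_le_iff]
  rintro x (rfl | rfl)
  · exact sqrt_p_mem p q
  · have ha : (a : ℝ) ≠ 0 := by exact_mod_cast T.a_pos.ne'
    rw [show √(r : ℝ) = √(p : ℝ) * √(q : ℝ) / a by rw [T.sqrt_mul_sqrt]; field_simp]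
    exact div_mem (mul_mem (sqrt_p_mem p q) (sqrt_q_mem p q)) (natCast_mem _ a)

theorem biquadraticField_swap_qr (T : BiquadTriple p q r a b c) :
    biquadraticField p r = biquadraticField p q :=
  le_antisymm T.biquadraticField_le T.swap_qr.biquadraticField_le

theorem biquadraticField_rp (T : BiquadTriple p q r a b c) :
    biquadraticField r p = biquadraticField p q := by
  rw [biquadraticField_comm r p, T.biquadraticField_swap_qr]

theorem sqrt_r_mem (T : BiquadTriple p q r a b c) : √(r : ℝ) ∈ biquadraticField p q :=
  T.biquadraticField_swap_qr ▸ sqrt_q_mem p r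

/-- From `√q = s + t√p`, one of `√q`, `√r`, `√p` would be rational according as `t = 0`, `s = 0` or
neither: multiply by `√p` in the second case, square in the third. -/
theorem sqrt_q_notMem (T : BiquadTriple p q r a b c) : √(q : ℝ) ∉ quadraticField p := by
  intro h
  obtain ⟨s, t, hst⟩ := exists_coords_quadraticField h
  have hp2 : √(p : ℝ) * √(p : ℝ) = p := Real.mul_self_sqrt (Nat.cast_nonneg p)
  have hq2 : √(q : ℝ) * √(q : ℝ) = q := Real.mul_self_sqrt (Nat.cast_nonneg q)
  have hpi := irrational_sqrt_of_squarefree T.sqf_p T.one_lt_p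
  have hqi := irrational_sqrt_of_squarefree T.sqf_q T.one_lt_q
  have hri := irrational_sqrt_of_squarefree T.sqf_r T.one_lt_r
  have ha : (a : ℝ) ≠ 0 := by exact_mod_cast T.a_pos.ne'
  by_cases ht : t = 0
  · exact hqi ⟨s, by rw [hst, ht]; simp⟩
  · by_cases hs : s = 0
    · refine hri ⟨t * p / a, ?_⟩
      push_cast
      rw [div_eq_iff ha]
      have := T.sqrt_mul_sqrt
      rw [hst, hs] at this
      push_cast at this
      linear_combination this - t * hp2
    · have hs' : (s : ℝ) ≠ 0 := by exact_mod_cast hs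
      have ht' : (t : ℝ) ≠ 0 := by exact_mod_cast ht
      refine hpi ⟨(q - s ^ 2 - t ^ 2 * p) / (2 * s * t), ?_⟩
      push_cast
      rw [div_eq_iff (by positivity)]
      rw [hst] at hq2
      linear_combination (-1 : ℝ) * hq2 + t ^ 2 * hp2

theorem exists_coords (T : BiquadTriple p q r a b c) {x : ℝ} (hx : x ∈ biquadraticField p q) :
    ∃ x₀ x₁ x₂ x₃ : ℚ, x = x₀ + x₁ * √(p : ℝ) + x₂ * √(q : ℝ) + x₃ * √(r : ℝ) := by
  have hp2 : √(p : ℝ) * √(p : ℝ) = p := Real.mul_self_sqrt (Nat.cast_nonneg p)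
  have hq2 : √(q : ℝ) * √(q : ℝ) = q := Real.mul_self_sqrt (Nat.cast_nonneg q)
  have hr2 : √(r : ℝ) * √(r : ℝ) = r := Real.mul_self_sqrt (Nat.cast_nonneg r)
  have hpq := T.sqrt_mul_sqrt
  have hpr := T.swap_qr.sqrt_mul_sqrt
  have hqr := T.swap_pq.swap_qr.sqrt_mul_sqrt
  rw [biquadraticField, ← IntermediateField.mem_toSubalgebra,
    IntermediateField.adjoin_toSubalgebra_of_isAlgebraic (by
      rintro y (rfl | rfl)
      exacts [isAlgebraic_sqrt p, isAlgebraic_sqrt q])] at hx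
  induction hx using Algebra.adjoin_induction with
  | mem y hy =>
    rcases hy with rfl | rfl
    · exact ⟨0, 1, 0, 0, by simp⟩
    · exact ⟨0, 0, 1, 0, by simp⟩
  | algebraMap d => exact ⟨d, 0, 0, 0, by simp⟩
  | add y z _ _ hy hz =>
    obtain ⟨y₀, y₁, y₂, y₃, rfl⟩ := hy
    obtain ⟨z₀, z₁, z₂, z₃, rfl⟩ := hz
    exact ⟨y₀ + z₀, y₁ + z₁, y₂ + z₂, y₃ + z₃, by push_cast; ring⟩
  | mul y z _ _ hy hz =>
    obtain ⟨y₀, y₁, y₂, y₃, rfl⟩ := hy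
    obtain ⟨z₀, z₁, z₂, z₃, rfl⟩ := hz
    refine ⟨y₀ * z₀ + y₁ * z₁ * p + y₂ * z₂ * q + y₃ * z₃ * r,
      y₀ * z₁ + y₁ * z₀ + (y₂ * z₃ + y₃ * z₂) * c,
      y₀ * z₂ + y₂ * z₀ + (y₁ * z₃ + y₃ * z₁) * b,
      y₀ * z₃ + y₃ * z₀ + (y₁ * z₂ + y₂ * z₁) * a, ?_⟩
    push_cast
    linear_combination (y₁ * z₁ : ℝ) * hp2 + (y₂ * z₂ : ℝ) * hq2 + (y₃ * z₃ : ℝ) * hr2 +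
      (y₁ * z₂ + y₂ * z₁ : ℝ) * hpq + (y₁ * z₃ + y₃ * z₁ : ℝ) * hpr +
      (y₂ * z₃ + y₃ * z₂ : ℝ) * hqr

/-- The conjugation that fixes `√p` and changes the sign of `√q` and `√r`. -/
theorem exists_embedding (T : BiquadTriple p q r a b c) {K : IntermediateField ℚ ℝ}
    (hK : K = biquadraticField p q) :
    ∃ σ : K →+* ℂ, ∀ (x : K) (x₀ x₁ x₂ x₃ : ℚ),
      (x : ℝ) = x₀ + x₁ * √(p : ℝ) + x₂ * √(q : ℝ) + x₃ * √(r : ℝ) →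
      σ x = ((x₀ + x₁ * √(p : ℝ) - x₂ * √(q : ℝ) - x₃ * √(r : ℝ) : ℝ) : ℂ) := by
  subst hK
  obtain ⟨σ, hσp, hσq⟩ := exists_embedding_neg (quadraticField p) (biquadraticField p q)
    (s := √(q : ℝ)) T.sqrt_q_notMem
    (by rw [Real.sq_sqrt (Nat.cast_nonneg q)]; exact natCast_mem _ q)
    (by
      rw [biquadraticField, IntermediateField.adjoin_le_iff]
      rintro x (rfl | rfl)
      · exact (le_sup_left : quadraticField p ≤ _) (sqrt_mem_quadraticField p)
      · exact (le_sup_right : IntermediateField.adjoin ℚ {√(q : ℝ)} ≤ _)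
          (IntermediateField.mem_adjoin_simple_self ℚ _))
  have ha : (a : ℂ) ≠ 0 := by exact_mod_cast T.a_pos.ne'
  set P : biquadraticField p q := ⟨√(p : ℝ), sqrt_p_mem p q⟩ with hP
  set Q : biquadraticField p q := ⟨√(q : ℝ), sqrt_q_mem p q⟩ with hQ
  set R : biquadraticField p q := ⟨√(r : ℝ), T.sqrt_r_mem⟩ with hR
  have h1 : σ P = ((√(p : ℝ) : ℝ) : ℂ) := hσp P (sqrt_mem_quadraticField p)
  have h2 : σ Q = ((-√(q : ℝ) : ℝ) : ℂ) := hσq Q rfl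
  have h3 : σ R = ((-√(r : ℝ) : ℝ) : ℂ) := by
    have e : P * Q = (a : biquadraticField p q) * R := Subtype.ext (by
      simpa [hP, hQ, hR] using T.sqrt_mul_sqrt)
    have := congrArg σ e
    rw [map_mul, map_mul, map_natCast, h1, h2] at this
    apply mul_left_cancel₀ ha
    rw [← this]
    have e' := T.sqrt_mul_sqrt
    have : √(p : ℝ) * -√(q : ℝ) = a * -√(r : ℝ) := by linarith
    exact_mod_cast this
  refine ⟨σ, fun x x₀ x₁ x₂ x₃ hx => ?_⟩
  have : x = (x₀ : biquadraticField p q) + x₁ * P + x₂ * Q + x₃ * R :=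
    Subtype.ext (by rw [hx]; simp [hP, hQ, hR])
  rw [this]
  simp only [map_add, map_mul, map_ratCast, h1, h2, h3]
  push_cast
  ring

/-- The conjugates of an integer of the biquadratic field are integral, and those of a totally
positive element are positive. -/
theorem conj_properties (T : BiquadTriple p q r a b c) {x : biquadraticField p q}
    {x₀ x₁ x₂ x₃ : ℚ}
    (hx : (x : ℝ) = x₀ + x₁ * √(p : ℝ) + x₂ * √(q : ℝ) + x₃ * √(r : ℝ)) :
    (IsIntegral ℤ x →
      IsIntegral ℤ (x₀ + x₁ * √(p : ℝ) - x₂ * √(q : ℝ) - x₃ * √(r : ℝ)) ∧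
      IsIntegral ℤ (x₀ - x₁ * √(p : ℝ) + x₂ * √(q : ℝ) - x₃ * √(r : ℝ)) ∧
      IsIntegral ℤ (x₀ - x₁ * √(p : ℝ) - x₂ * √(q : ℝ) + x₃ * √(r : ℝ))) ∧
    (TotallyPositive x →
      0 < (x₀ + x₁ * √(p : ℝ) + x₂ * √(q : ℝ) + x₃ * √(r : ℝ)) ∧
      0 < (x₀ + x₁ * √(p : ℝ) - x₂ * √(q : ℝ) - x₃ * √(r : ℝ)) ∧
      0 < (x₀ - x₁ * √(p : ℝ) + x₂ * √(q : ℝ) - x₃ * √(r : ℝ)) ∧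
      0 < (x₀ - x₁ * √(p : ℝ) - x₂ * √(q : ℝ) + x₃ * √(r : ℝ))) := by
  obtain ⟨σ, hσ⟩ := T.exists_embedding rfl
  obtain ⟨τ, hτ⟩ := T.swap_pq.exists_embedding (biquadraticField_comm p q)
  obtain ⟨ρ, hρ⟩ := T.swap_qr.swap_pq.exists_embedding T.biquadraticField_rp.symm
  have h1 := hσ x x₀ x₁ x₂ x₃ hx
  have h2 := hτ x x₀ x₂ x₁ x₃ (by rw [hx]; ring)
  have h3 := hρ x x₀ x₃ x₁ x₂ (by rw [hx]; ring)
  rw [show x₀ + x₂ * √(q : ℝ) - x₁ * √(p : ℝ) - x₃ * √(r : ℝ) =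
    x₀ - x₁ * √(p : ℝ) + x₂ * √(q : ℝ) - x₃ * √(r : ℝ) by ring] at h2
  rw [show x₀ + x₃ * √(r : ℝ) - x₁ * √(p : ℝ) - x₂ * √(q : ℝ) =
    x₀ - x₁ * √(p : ℝ) - x₂ * √(q : ℝ) + x₃ * √(r : ℝ) by ring] at h3
  refine ⟨fun hint => ⟨isIntegral_of_embedding σ h1 hint, isIntegral_of_embedding τ h2 hint,
    isIntegral_of_embedding ρ h3 hint⟩, fun hpos => ⟨?_, ?_, ?_, ?_⟩⟩
  · rw [← hx]
    exact Complex.zero_lt_real.1 (hpos (Complex.ofRealHom.comp (algebraMap _ ℝ)))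
  · exact Complex.zero_lt_real.1 (h1 ▸ hpos σ)
  · exact Complex.zero_lt_real.1 (h2 ▸ hpos τ)
  · exact Complex.zero_lt_real.1 (h3 ▸ hpos ρ)

/-- Four times the coordinates of an integer of the biquadratic field are integers. -/
theorem exists_quarter_coords (T : BiquadTriple p q r a b c) {x : biquadraticField p q}
    (hint : IsIntegral ℤ x) {x₀ x₁ x₂ x₃ : ℚ}
    (hx : (x : ℝ) = x₀ + x₁ * √(p : ℝ) + x₂ * √(q : ℝ) + x₃ * √(r : ℝ)) :
    ∃ m n₁ n₂ n₃ : ℤ, 4 * x₀ = m ∧ 4 * x₁ = n₁ ∧ 4 * x₂ = n₂ ∧ 4 * x₃ = n₃ ∧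
      HalfIntegral p m n₁ ∧ HalfIntegral q m n₂ ∧ HalfIntegral r m n₃ := by
  obtain ⟨i1, i2, i3⟩ := (T.conj_properties hx).1 hint
  have i0 : IsIntegral ℤ (x₀ + x₁ * √(p : ℝ) + x₂ * √(q : ℝ) + x₃ * √(r : ℝ)) := by
    rw [← hx]; exact isIntegral_coe_iff.2 hint
  -- The three relative traces `2x₀ + 2x_i√k` are integers of the quadratic subfields; they share
  -- the rational part, hence the same `m`.
  have key : ∀ {k : ℕ} {y : ℚ} {z w : ℝ}, Squarefree k → 1 < k → IsIntegral ℤ z → IsIntegral ℤ w →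
      z + w = 2 * x₀ + 2 * y * √(k : ℝ) →
      ∃ m n : ℤ, 4 * x₀ = m ∧ 4 * y = n ∧ HalfIntegral k m n := by
    intro k y z w hk h1 hz hw e
    have h := hz.add hw
    rw [e] at h
    obtain ⟨m, n, hm, hn, h'⟩ := exists_halfIntegral (s := 2 * x₀) (t := 2 * y) hk h1
      (by push_cast; exact h)
    exact ⟨m, n, by rw [← hm]; ring, by rw [← hn]; ring, h'⟩
  obtain ⟨m, n₁, hm, hn₁, h₁⟩ := key (y := x₁) T.sqf_p T.one_lt_p i0 i1 (by ring)
  obtain ⟨m₂, n₂, hm₂, hn₂, h₂⟩ := key (y := x₂) T.sqf_q T.one_lt_q i0 i2 (by ring)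
  obtain ⟨m₃, n₃, hm₃, hn₃, h₃⟩ := key (y := x₃) T.sqf_r T.one_lt_r i0 i3 (by ring)
  have e2 : m₂ = m := by exact_mod_cast hm₂.symm.trans hm
  have e3 : m₃ = m := by exact_mod_cast hm₃.symm.trans hm
  subst e2 e3
  exact ⟨_, n₁, n₂, n₃, hm, hn₁, hn₂, hn₃, h₁, h₂, h₃⟩

/-! ### Criteria for staying indecomposable -/

/-- An indecomposable of `ℚ(√p)` stays indecomposable in the biquadratic field if the summands of
every decomposition have their `ℚ(√p)`-component in `ℤ[ω_p]`. -/
theorem indecomposableIn_of_component (T : BiquadTriple p q r a b c) {s t : ℤ}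
    (hind : IndecomposablePair p s t)
    (hcomp : ∀ (y z : 𝓞 (biquadraticField p q)) (x₀ x₁ x₂ x₃ : ℚ),
      TotallyPositive (y : biquadraticField p q) → TotallyPositive (z : biquadraticField p q) →
      ((y : biquadraticField p q) : ℝ) + ((z : biquadraticField p q) : ℝ) = s + t * omega p →
      ((y : biquadraticField p q) : ℝ) =
        x₀ + x₁ * √(p : ℝ) + x₂ * √(q : ℝ) + x₃ * √(r : ℝ) →
      ∃ m n : ℤ, 2 * x₀ = m ∧ 2 * x₁ = n ∧ HalfIntegral p m n) :
    IndecomposableIn (biquadraticField p q) (s + t * omega p) := by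
  refine ⟨integerOf (sqrt_p_mem p q) s t, rfl, totallyPositive_integerOf _ hind.1, ?_⟩
  rintro ⟨y, z, hy, hz, hyz⟩
  have hsum : ((y : biquadraticField p q) : ℝ) + ((z : biquadraticField p q) : ℝ) =
      s + t * omega p := by
    rw [← coe_integerOf (sqrt_p_mem p q) s t, hyz]
    rfl
  obtain ⟨x₀, x₁, x₂, x₃, hx⟩ := T.exists_coords (y : biquadraticField p q).2
  obtain ⟨m, n, hm, hn, hmn⟩ := hcomp y z x₀ x₁ x₂ x₃ hy hz hsum hx
  obtain ⟨c₁, d₁, e, e'⟩ := exists_omega_coords hmn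
  obtain ⟨s', t', f, f'⟩ := exists_sqrt_coords p s t
  have hm' : (m : ℝ) = 2 * x₀ := by exact_mod_cast hm.symm
  have hn' : (n : ℝ) = 2 * x₁ := by exact_mod_cast hn.symm
  rw [hm', hn'] at e e'
  have hz' : ((z : biquadraticField p q) : ℝ) = (s' - x₀ : ℚ) + (t' - x₁ : ℚ) * √(p : ℝ) +
      (-x₂ : ℚ) * √(q : ℝ) + (-x₃ : ℚ) * √(r : ℝ) := by
    push_cast
    rw [f] at hsum
    linarith
  obtain ⟨y0, y1, y2, y3⟩ := (T.conj_properties hx).2 hy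
  obtain ⟨z0, z1, z2, z3⟩ := (T.conj_properties hz').2 hz
  push_cast at z0 z1 z2 z3
  refine hind.2 c₁ d₁ (s - c₁) (t - d₁) ⟨?_, ?_⟩ ⟨?_, ?_⟩ (by ring) (by ring)
  · linarith
  · linarith
  · push_cast
    linarith
  · push_cast
    linarith

/-- This makes `κ = aδ/√q = (a n₂ + n₃√p)/2` an algebraic integer. Either all of `m`, `n₂`, `n₃` are
even, or all are odd, and then `p ≡ 1` modulo `4` and `a` is odd. -/
theorem halfIntegral_difference (T : BiquadTriple p q r a b c) {m n₁ n₂ n₃ : ℤ}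
    (h₁ : HalfIntegral p m n₁) (h₂ : HalfIntegral q m n₂) (h₃ : HalfIntegral r m n₃) :
    HalfIntegral p (a * n₂) n₃ := by
  unfold HalfIntegral at *
  by_cases hm : m % 2 = 0
  · have e2 : n₂ % 2 = 0 := by omega
    have e3 : n₃ % 2 = 0 := by omega
    have : (a * n₂) % 2 = 0 := by rw [Int.mul_emod, e2]; simp
    omega
  · have hp : p % 4 = 1 := by by_contra h; exact hm (h₁.2 h).1
    have ha : a % 2 = 1 := by
      have h : (a * b) % 2 = 1 := by rw [← T.p_eq]; omega
      exact (Nat.odd_mul.1 (Nat.odd_iff.2 h)).1 |> Nat.odd_iff.1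
    have : (a * n₂) % 2 = 1 := by
      rw [Int.mul_emod, show (a : ℤ) % 2 = 1 by omega, show n₂ % 2 = 1 by omega]
      rfl
    omega

/-- If `√r > N √p` and no nonzero integer of `ℚ(√p)` is smaller than `α / N` under both embeddings,
then the indecomposable `α` of `ℚ(√p)` stays indecomposable. -/
theorem indecomposableIn_of_rigid (T : BiquadTriple p q r a b c) {N : ℕ} {s t : ℤ}
    (hind : IndecomposablePair p s t) (hrig : Rigid N p s t)
    (hN : √(r : ℝ) > N * √(p : ℝ)) :
    IndecomposableIn (biquadraticField p q) (s + t * omega p) := by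
  refine T.indecomposableIn_of_component hind fun y z x₀ x₁ x₂ x₃ hy hz hsum hx => ?_
  have hyint := NumberField.RingOfIntegers.isIntegral_coe y
  obtain ⟨s', t', f, f'⟩ := exists_sqrt_coords p s t
  have hz' : ((z : biquadraticField p q) : ℝ) = (s' - x₀ : ℚ) + (t' - x₁ : ℚ) * √(p : ℝ) +
      (-x₂ : ℚ) * √(q : ℝ) + (-x₃ : ℚ) * √(r : ℝ) := by
    push_cast
    rw [f] at hsum
    linarith
  obtain ⟨y0, y1, y2, y3⟩ := (T.conj_properties hx).2 hy
  obtain ⟨z0, z1, z2, z3⟩ := (T.conj_properties hz').2 hz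
  push_cast at z0 z1 z2 z3
  obtain ⟨m, n₁, n₂, n₃, hm, hn₁, hn₂, hn₃, h₁, h₂, h₃⟩ := T.exists_quarter_coords hyint hx
  obtain ⟨k, l, e, e'⟩ := exists_omega_coords (T.halfIntegral_difference h₁ h₂ h₃)
  have hn₂' : (n₂ : ℝ) = 4 * x₂ := by exact_mod_cast hn₂.symm
  have hn₃' : (n₃ : ℝ) = 4 * x₃ := by exact_mod_cast hn₃.symm
  push_cast at e e'
  rw [hn₂', hn₃'] at e e'
  have ha : (0 : ℝ) < a := by exact_mod_cast T.a_pos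
  have hp0 : 0 < √(p : ℝ) := by linarith [one_lt_sqrt_natCast T.one_lt_p]
  have hq0 : 0 < √(q : ℝ) := by linarith [one_lt_sqrt_natCast T.one_lt_q]
  have hpq := T.sqrt_mul_sqrt
  -- `√q / a = √r / √p`
  have hNa : N * a ≤ √(q : ℝ) := by
    have h2 : √(p : ℝ) * √(p : ℝ) = p := Real.mul_self_sqrt (Nat.cast_nonneg p)
    have : √(p : ℝ) * (N * a) ≤ √(p : ℝ) * √(q : ℝ) := by
      rw [hpq]
      nlinarith [mul_lt_mul_of_pos_left hN ha]
    exact le_of_mul_le_mul_left this hp0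
  -- Applied to `δ = y - σ y` and to its analogue for the other embedding of `ℚ(√p)`. The bounds on
  -- `δ` hold because `y`, `z` and their conjugates are positive.
  have small : ∀ κ δ A : ℝ, a * δ = √(q : ℝ) * κ → δ < A → -A < δ → N * |κ| < A := by
    intro κ δ A h hδ hδ'
    have h1 : a * |δ| = √(q : ℝ) * |κ| := by
      rw [← abs_of_pos ha, ← abs_mul, h, abs_mul, abs_of_pos hq0]
    have h2 : |δ| < A := abs_lt.2 ⟨hδ', hδ⟩
    have h3 : a * (N * |κ|) ≤ a * |δ| := by
      rw [h1]
      nlinarith [mul_le_mul_of_nonneg_right hNa (abs_nonneg κ)]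
    exact (le_of_mul_le_mul_left h3 ha).trans_lt h2
  obtain ⟨hk, hl⟩ := hrig k l
    (by
      refine small _ (2 * x₂ * √(q : ℝ) + 2 * x₃ * √(r : ℝ)) _ ?_ ?_ ?_
      · rw [e]; linear_combination (-2 * x₃ : ℝ) * hpq
      · rw [f]; linarith
      · rw [f]; linarith)
    (by
      refine small _ (2 * x₂ * √(q : ℝ) - 2 * x₃ * √(r : ℝ)) _ ?_ ?_ ?_
      · rw [e']; linear_combination (2 * x₃ : ℝ) * hpq
      · rw [f']; linarith
      · rw [f']; linarith)
  rw [hk, hl] at e e'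
  have hx₂ : x₂ = 0 := by
    have : (a : ℝ) * x₂ = 0 := by push_cast at e e'; linarith
    have := (mul_eq_zero.1 this).resolve_left ha.ne'
    exact_mod_cast this
  have hx₃ : x₃ = 0 := by
    have : (x₃ : ℝ) * √(p : ℝ) = 0 := by push_cast at e e'; linarith
    have := (mul_eq_zero.1 this).resolve_right hp0.ne'
    exact_mod_cast this
  subst hx₂ hx₃
  -- Now `y` is its own `ℚ(√p)`-component, so its integrality is all that is needed.
  refine exists_halfIntegral T.sqf_p T.one_lt_p ?_
  have := isIntegral_coe_iff.2 hyint
  rw [hx] at this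
  simpa using this

/-- The hypotheses `hm`, `hn`, `hmn` express that the relative norm of `(n₀ + n₁√p + n₂√q + n₃√r)/2`
is an integer of `ℚ(√p)`. For even `q`, also `c` and `r` are even, and reduction modulo `2`
suffices; for `(p, q) ≡ (1, 3)` one works modulo `4`. -/
theorem halfIntegral_component (T : BiquadTriple p q r a b c)
    (hmod : p % 4 = 3 ∧ q % 4 = 2 ∨ p % 4 = 1 ∧ q % 4 = 2 ∨ p % 4 = 1 ∧ q % 4 = 3)
    {m n n₀ n₁ n₂ n₃ : ℤ}
    (hm : n₀ ^ 2 + p * n₁ ^ 2 - q * n₂ ^ 2 - r * n₃ ^ 2 = 2 * m)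
    (hn : n₀ * n₁ - n₂ * n₃ * c = n) (hmn : HalfIntegral p m n) :
    HalfIntegral p n₀ n₁ := by
  have res : ∀ x : ℕ, x < 4 → ∀ y : ℕ, y < 4 → ∀ z : ℕ, z < 4 →
      (x * y % 4 = 3 ∨ x * y % 4 = 1 → x * z % 4 = 2 → z % 2 = 0) ∧
      (x * y % 4 = 1 → x * z % 4 = 3 → y * z % 4 = 3 ∧ z % 2 = 1) := by
    intro x hx y hy z hz
    interval_cases x <;> interval_cases y <;> interval_cases z <;> simp
  have hres := res (a % 4) (Nat.mod_lt _ (by norm_num)) (b % 4) (Nat.mod_lt _ (by norm_num))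
    (c % 4) (Nat.mod_lt _ (by norm_num))
  rw [← Nat.mul_mod, ← Nat.mul_mod, ← Nat.mul_mod, ← T.p_eq, ← T.q_eq, ← T.r_eq] at hres
  obtain ⟨hres1, hres2⟩ := hres
  have even_case : q % 4 = 2 → c % 2 = 0 → p % 2 = 1 → (n₀ - n₁) % 2 = 0 := by
    intro hq hc hp
    have hr : r % 2 = 0 := by rw [T.r_eq, Nat.mul_mod, hc]; simp
    have hp' : ¬ Even p := by rw [Nat.even_iff]; omega
    have hq' : Even q := Nat.even_iff.2 (by omega)
    have hr' : Even r := Nat.even_iff.2 hr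
    have h : Even (n₀ ^ 2 + p * n₁ ^ 2 - q * n₂ ^ 2 - r * n₃ ^ 2) := by
      rw [hm]; exact even_two_mul m
    simp only [Int.even_sub, Int.even_add, Int.even_mul, Int.even_pow, Int.even_coe_nat, hp', hq',
      hr', true_or, iff_true, false_or, ne_eq, OfNat.ofNat_ne_zero, not_false_eq_true,
      and_true] at h
    rw [← Int.even_iff, Int.even_sub]
    exact h
  unfold HalfIntegral at *
  rcases hmod with ⟨hp, hq⟩ | ⟨hp, hq⟩ | ⟨hp, hq⟩
  · have hc : c % 2 = 0 := by omega
    have hdiff := even_case hq hc (by omega)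
    have hc' : Even c := Nat.even_iff.2 hc
    have hev : Even (n₀ * n₁ - n₂ * n₃ * c) := by
      rw [hn, Int.even_iff]
      exact (hmn.2 (by omega)).2
    simp only [Int.even_sub, Int.even_mul, Int.even_coe_nat, hc', or_true, iff_true] at hev
    rw [Int.even_iff, Int.even_iff] at hev
    omega
  · exact ⟨even_case hq (by omega) (by omega), by omega⟩
  · obtain ⟨hr, hc⟩ := hres2 hp hq
    refine ⟨?_, by omega⟩
    obtain ⟨p', hp'⟩ : ∃ k : ℤ, (p : ℤ) = 4 * k + 1 := ⟨p / 4, by omega⟩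
    obtain ⟨q', hq'⟩ : ∃ k : ℤ, (q : ℤ) = 4 * k + 3 := ⟨q / 4, by omega⟩
    obtain ⟨r', hr'⟩ : ∃ k : ℤ, (r : ℤ) = 4 * k + 3 := ⟨r / 4, by omega⟩
    obtain ⟨c', hc'⟩ : ∃ k : ℤ, (c : ℤ) = 2 * k + 1 := ⟨c / 2, by omega⟩
    obtain ⟨j, hj⟩ : ∃ j, m = n + 2 * j := ⟨(m - n) / 2, by omega⟩
    rw [hp', hq', hr', hj, ← hn, hc'] at hm
    -- A sum of two squares divisible by `4` has both terms even.
    have key : (n₀ - n₁) ^ 2 + (n₂ + n₃) ^ 2 =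
        4 * (j - p' * n₁ ^ 2 + (q' + 1) * n₂ ^ 2 + (r' + 1) * n₃ ^ 2 - c' * n₂ * n₃) := by
      linear_combination hm
    generalize n₀ - n₁ = x at *
    rcases Int.even_or_odd' x with ⟨y, rfl | rfl⟩
    · omega
    · exfalso
      rcases Int.even_or_odd' (n₂ + n₃) with ⟨w, hw | hw⟩ <;> rw [hw] at key <;> ring_nf at key <;>
        omega

/-- For these residues every integer of the biquadratic field has its `ℚ(√p)`-component in `ℤ[ω_p]`,
so every indecomposable of `ℚ(√p)` stays indecomposable. -/
theorem indecomposableIn_of_mod_four (T : BiquadTriple p q r a b c)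
    (hmod : p % 4 = 3 ∧ q % 4 = 2 ∨ p % 4 = 1 ∧ q % 4 = 2 ∨ p % 4 = 1 ∧ q % 4 = 3) {s t : ℤ}
    (hind : IndecomposablePair p s t) :
    IndecomposableIn (biquadraticField p q) (s + t * omega p) := by
  refine T.indecomposableIn_of_component hind fun y z x₀ x₁ x₂ x₃ hy hz hsum hx => ?_
  have hyint := NumberField.RingOfIntegers.isIntegral_coe y
  obtain ⟨m, n₁, n₂, n₃, hm, hn₁, hn₂, hn₃, h₁, h₂, h₃⟩ := T.exists_quarter_coords hyint hx
  -- Since `q` is not `1` modulo `4`, `m` is even, and all numerators have the parity of `m`: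
  -- denominators `4` reduce to `2`.
  have hev : m % 2 = 0 ∧ n₁ % 2 = 0 ∧ n₂ % 2 = 0 ∧ n₃ % 2 = 0 := by
    have := h₂.2 (by omega)
    have := h₁.1
    have := h₃.1
    omega
  obtain ⟨k₀, rfl⟩ : ∃ k, m = 2 * k := ⟨m / 2, by omega⟩
  obtain ⟨k₁, rfl⟩ : ∃ k, n₁ = 2 * k := ⟨n₁ / 2, by omega⟩
  obtain ⟨k₂, rfl⟩ : ∃ k, n₂ = 2 * k := ⟨n₂ / 2, by omega⟩
  obtain ⟨k₃, rfl⟩ : ∃ k, n₃ = 2 * k := ⟨n₃ / 2, by omega⟩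
  push_cast at hm hn₁ hn₂ hn₃
  have hx₀ : 2 * x₀ = k₀ := by linarith
  have hx₁ : 2 * x₁ = k₁ := by linarith
  have hx₂ : 2 * x₂ = k₂ := by linarith
  have hx₃ : 2 * x₃ = k₃ := by linarith
  have hp2 : √(p : ℝ) * √(p : ℝ) = p := Real.mul_self_sqrt (Nat.cast_nonneg p)
  have hq2 : √(q : ℝ) * √(q : ℝ) = q := Real.mul_self_sqrt (Nat.cast_nonneg q)
  have hr2 : √(r : ℝ) * √(r : ℝ) = r := Real.mul_self_sqrt (Nat.cast_nonneg r)
  have hqr := T.swap_pq.swap_qr.sqrt_mul_sqrt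
  have hnorm := (isIntegral_coe_iff.2 hyint).mul ((T.conj_properties hx).1 hyint).1
  rw [hx, show (x₀ + x₁ * √(p : ℝ) + x₂ * √(q : ℝ) + x₃ * √(r : ℝ)) *
      (x₀ + x₁ * √(p : ℝ) - x₂ * √(q : ℝ) - x₃ * √(r : ℝ)) =
      ((x₀ ^ 2 + p * x₁ ^ 2 - q * x₂ ^ 2 - r * x₃ ^ 2 : ℚ) : ℝ) +
        ((2 * x₀ * x₁ - 2 * x₂ * x₃ * c : ℚ) : ℝ) * √(p : ℝ) by
    push_cast
    linear_combination (x₁ ^ 2 : ℝ) * hp2 - (x₂ ^ 2 : ℝ) * hq2 - (x₃ ^ 2 : ℝ) * hr2 -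
      (2 * x₂ * x₃ : ℝ) * hqr] at hnorm
  obtain ⟨m', n', hm', hn', hmn'⟩ := exists_halfIntegral T.sqf_p T.one_lt_p hnorm
  refine ⟨k₀, k₁, hx₀, hx₁, T.halfIntegral_component hmod (n₂ := k₂) (n₃ := k₃) ?_ ?_ hmn'⟩
  · have : ((k₀ ^ 2 + p * k₁ ^ 2 - q * k₂ ^ 2 - r * k₃ ^ 2 : ℤ) : ℚ) = (2 * m' : ℤ) := by
      push_cast
      rw [← hm', ← hx₀, ← hx₁, ← hx₂, ← hx₃]
      ring
    exact_mod_cast this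
  · have : ((k₀ * k₁ - k₂ * k₃ * c : ℤ) : ℚ) = (n' : ℤ) := by
      push_cast
      rw [← hn', ← hx₀, ← hx₁, ← hx₂, ← hx₃]
      ring
    exact_mod_cast this

/-- The criteria for an indecomposable of `ℚ(√p)` to stay indecomposable that depend on the size
of `r`. -/
theorem indecomposableIn_of_size (T : BiquadTriple p q r a b c) {α : ℝ}
    (hα : IndecomposableIn (quadraticField p) α) :
    (IsConvergent p α → √(r : ℝ) > √(p : ℝ) → IndecomposableIn (biquadraticField p q) α) ∧
    (√(r : ℝ) > maxOddQuotient p * √(p : ℝ) → IndecomposableIn (biquadraticField p q) α) := by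
  obtain ⟨s, t, rfl, hind⟩ := exists_indecomposablePair T.sqf_p T.one_lt_p hα
  refine ⟨fun hc h => ?_, fun h => ?_⟩
  · exact T.indecomposableIn_of_rigid hind
      (rigid_one_of_isConvergent T.sqf_p T.one_lt_p hind.1 hc) (by rwa [Nat.cast_one, one_mul])
  · exact T.indecomposableIn_of_rigid hind (rigid_maxOddQuotient T.sqf_p T.one_lt_p hind) h

end BiquadTriple

end BiquadIndec

end

/-! ### The theorem, by permuting the three quadratic subfields -/

open BiquadIndec in
theorem theorem1p1 (p q r : ℕ) (hp : Squarefree p) (hq : Squarefree q)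
    (hp1 : 1 < p) (hq1 : 1 < q) (hpq : p ≠ q) (hr : r = p * q / Nat.gcd p q ^ 2) :
    (∀ α : ℝ, IndecomposableIn (quadraticField p) α →
      (IsConvergent p α → √(r : ℝ) > √(p : ℝ) → IndecomposableIn (biquadraticField p q) α) ∧
      (√(r : ℝ) > maxOddQuotient p * √(p : ℝ) → IndecomposableIn (biquadraticField p q) α)) ∧
    (∀ β : ℝ, IndecomposableIn (quadraticField q) β →
      ((p % 4 = 2 ∧ q % 4 = 3) ∨ (p % 4 = 2 ∧ q % 4 = 1) ∨ (p % 4 = 3 ∧ q % 4 = 1) →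
        IndecomposableIn (biquadraticField p q) β) ∧
      (p % 4 = 1 ∧ q % 4 = 1 →
        (√(r : ℝ) > √(q : ℝ) → IsConvergent q β → IndecomposableIn (biquadraticField p q) β) ∧
        (√(r : ℝ) > maxOddQuotient q * √(q : ℝ) →
          IndecomposableIn (biquadraticField p q) β))) ∧
    (∀ γ : ℝ, IndecomposableIn (quadraticField r) γ →
      (IsConvergent r γ → √(p : ℝ) > √(r : ℝ) → IndecomposableIn (biquadraticField p q) γ) ∧
      (√(p : ℝ) > maxOddQuotient r * √(r : ℝ) → IndecomposableIn (biquadraticField p q) γ)) := by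
  obtain ⟨a, b, c, T⟩ := exists_biquadTriple hp hq hp1 hq1 hpq hr
  refine ⟨fun α hα => T.indecomposableIn_of_size hα, fun β hβ => ?_, fun γ hγ => ?_⟩
  · rw [biquadraticField_comm p q]
    refine ⟨fun hmod => ?_, fun _ => ?_⟩
    · obtain ⟨s, t, rfl, hind⟩ := exists_indecomposablePair hq hq1 hβ
      exact T.swap_pq.indecomposableIn_of_mod_four (by tauto) hind
    · have h := T.swap_pq.indecomposableIn_of_size hβ
      exact ⟨fun h1 h2 => h.1 h2 h1, h.2⟩
  -- The three swaps exchange `p` and `r`, so the size condition now compares `√p` with `√r`.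
  · have h := T.swap_pq.swap_qr.swap_pq.indecomposableIn_of_size hγ
    rwa [biquadraticField_comm r q, T.swap_pq.biquadraticField_swap_qr,
      biquadraticField_comm q p] at h
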